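/- Let $\alpha\in\mathbb R$. For $n\ge 2$ consider a closed chain of $n$ sites with single-excitation Hamiltonian $H=\sum_{1\le i<j\le n}J_{ij}\,(|i\rangle\langle j|+|j\rangle\langle i|)$, $J_{ij}=|j-i|^{-\alpha}+|n-(j-i)|^{-\alpha}$. Its eigenvalues are $\lambda_k=2\sum_{j=1}^{n-1}j^{-\alpha}\cos(2\pi kj/n)$, $k=1,\dots,n$; put $\tilde\lambda_k=(\lambda_k-\lambda_{\lfloor n/2\rfloor})/(\lambda_n-\lambda_{\lfloor n/2\rfloor})$ and define $$S_q=\frac1n\sum_{k=1}^{n-1}\frac1{(1-\tilde\lambda_k)^q},\qquad \nu_n=\frac{S_1}{\sqrt{S_2}},\qquad F_n=\nu_n^2,\qquad T_n=\frac{\pi}{2}\sqrt{\frac{n}{F_n}} .$$ For a hopping rate $\gamma$ and a marked site $w$, the search has success probability $P_{\gamma,w}(t)=\big|\langle w|e^{-it(\gamma H+|w\rangle\langle w|)}|s\rangle\big|^2$ at time $t$, where $|s\rangle=n^{-1/2}\sum_j|j\rangle$. As $n\to\infty$ the following hold. 1. If $1<\alpha<2$, then $S_1$ converges to a finite positive limit.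 2. If $1<\alpha<3/2$, then $S_2$ converges to a finite positive limit, and $\nu_n$ and $F_n$ converge to positive limits $\nu$ and $F_\infty=\nu^2$. The search runs in time $T_n=O(\sqrt n)$: there are rates $\gamma_n>0$, not depending on the marked site, such that for every $\varepsilon>0$ and all sufficiently large $n$, for every marked site $w$, $|P_{\gamma_n,w}(T_n)-F_\infty|<\varepsilon$ and $P_{\gamma_n,w}(t)<F_\infty+\varepsilon$ for all $t\in\mathbb R$. That is, at time $T_n$ the success probability asymptotically attains its maximum over all times, $F_\infty$. 3. If $\alpha>3/2$, then $S_2\to\infty$, $\nu_n\to0$ and $F_n\to0$. 4. Let $f(\alpha)=4\zeta(\alpha)-2^{2-\alpha}\zeta(\alpha)$, $g_0(\alpha)=-2^\alpha\pi^{\alpha-1}\sin(\tfrac{\alpha\pi}{2})\Gamma(1-\alpha)$, and let $$\bar S_q=\frac{2f(\alpha)^q}{g_0(\alpha)^q}\Big(n^{q\alpha-q-1}\zeta(q\alpha-q)+\frac{2^{q\alpha-q-1}}{1+q-q\alpha}\Big),\qquad \bar\nu_n=\frac{\bar S_1}{\sqrt{\bar S_2}} .$$ If $1<\alpha<3/2$,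 then for all sufficiently large $n$ $$\bar\nu_n^2=\frac{2\big(n^{\alpha-2}\zeta(\alpha-1)+\frac{2^{\alpha-2}}{2-\alpha}\big)^2}{n^{2\alpha-3}\zeta(2\alpha-2)+\frac{2^{2\alpha-3}}{3-2\alpha}},$$ and $\bar\nu_n\to\frac{\sqrt{3-2\alpha}}{2-\alpha}$, $\bar F_\infty:=\lim_n\bar\nu_n^2=\frac{3-2\alpha}{(2-\alpha)^2}$. -/

import Mathlib

open Filter Topology Asymptotics

noncomputable section

namespace LongRangeSearch

/-- Coupling between two distinct sites at distance `r` along a closed chain of `n` spins: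
`J = 1 / r ^ α + 1 / (n - r) ^ α`. -/
def coupling (α : ℝ) (n : ℕ) (r : ℝ) : ℝ := 1 / r ^ α + 1 / (n - r) ^ α

/-- The chain Hamiltonian in the single-excitation basis,
`H = ∑_{i<j} J_{ij} (|i⟩⟨j| + |j⟩⟨i|)`. -/
def hamiltonian (α : ℝ) (n : ℕ) : Matrix (Fin n) (Fin n) ℂ :=
  Matrix.of fun i j => if i = j then 0 else (coupling α n |(j : ℝ) - (i : ℝ)| : ℂ)

/-- The search Hamiltonian `γ H + |w⟩⟨w|` with hopping rate `γ` and marked site `w`. -/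
def searchHamiltonian (α γ : ℝ) (n : ℕ) (w : Fin n) : Matrix (Fin n) (Fin n) ℂ :=
  (γ : ℂ) • hamiltonian α n + Matrix.single w w 1

/-- The initial state `|s⟩ = n^{-1/2} ∑_j |j⟩`. -/
def initialState (n : ℕ) : Fin n → ℂ := fun _ => ((1 / √(n : ℝ) : ℝ) : ℂ)

/-- The probability `|⟨w| exp(-i t H_search) |s⟩|²` of finding the marked site at time `t`. -/
def fidelity (α γ : ℝ) (n : ℕ) (w : Fin n) (t : ℝ) : ℝ :=
  ‖(NormedSpace.exp ((-(Complex.I * (t : ℂ))) • searchHamiltonian α γ n w)).mulVec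
    (initialState n) w‖ ^ 2

/-- The eigenvalue of `H` for the Fourier state with wave number `k`. -/
def eigenvalue (α : ℝ) (n k : ℕ) : ℝ :=
  2 * ∑ j ∈ Finset.Ico 1 n, 1 / (j : ℝ) ^ α * Real.cos (2 * Real.pi * k * j / n)

/-- The eigenvalues rescaled to `[0, 1]`. The largest one is at `k = n` and the smallest one at
`k = ⌊n / 2⌋` (for odd `n` the wave numbers `(n - 1) / 2` and `(n + 1) / 2` give the same one). -/
def rescaledEigenvalue (α : ℝ) (n k : ℕ) : ℝ :=
  (eigenvalue α n k - eigenvalue α n (n / 2)) / (eigenvalue α n n - eigenvalue α n (n / 2))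

/-- `S_q = (1 / n) ∑_{k=1}^{n-1} (1 - λ̃_k)^{-q}`. -/
def S (q : ℕ) (α : ℝ) (n : ℕ) : ℝ :=
  1 / (n : ℝ) * ∑ k ∈ Finset.Ico 1 n, 1 / (1 - rescaledEigenvalue α n k) ^ q

/-- The analytical amplitude `ν = S_1 / √S_2` of a chain of `n` spins. -/
def amplitude (α : ℝ) (n : ℕ) : ℝ := S 1 α n / √(S 2 α n)

/-- The analytical fidelity `F_∞ = ν²` of a chain of `n` spins. -/
def analyticalFidelity (α : ℝ) (n : ℕ) : ℝ := amplitude α n ^ 2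

/-- The search time `T = (π / 2) √(n / F_∞)`. -/
def searchTime (α : ℝ) (n : ℕ) : ℝ :=
  Real.pi / 2 * √((n : ℝ) / analyticalFidelity α n)

/-- The Riemann zeta function at a real argument, where it is real. -/
def zetaReal (x : ℝ) : ℝ := (riemannZeta (x : ℂ)).re

/-- `f(α) = 4 ζ(α) - 2^{2-α} ζ(α)`. -/
def fCoeff (α : ℝ) : ℝ := 4 * zetaReal α - 2 ^ (2 - α) * zetaReal α

/-- `g_0(α) = -2^α π^{α-1} sin(α π / 2) Γ(1-α)`. -/
def gCoeff (α : ℝ) : ℝ :=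
  -(2 ^ α * Real.pi ^ (α - 1) * Real.sin (α * Real.pi / 2) * Real.Gamma (1 - α))

/-- The approximation `S̄_q` of `S_q`. -/
def approxS (q : ℕ) (α : ℝ) (n : ℕ) : ℝ :=
  2 * fCoeff α ^ q / gCoeff α ^ q *
    ((n : ℝ) ^ (q * α - q - 1) * zetaReal (q * α - q) +
      2 ^ (q * α - q - 1) / (1 + q - q * α))

/-- The approximation `ν̄ = S̄_1 / √S̄_2` of the analytical amplitude. -/
def approxAmplitude (α : ℝ) (n : ℕ) : ℝ := approxS 1 α n / √(approxS 2 α n)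

end LongRangeSearch

end

/-! Everything spectral is expressed through the gaps `gap α n k` = 2 ∑ j^{-α} (1 - cos(2πkj/n)):
S_q is the mean of (gap at n/2 / gap at k)^q over nonzero wave numbers. Near the band edge the gap
is at least of order min(k/n, 1 - k/n)^{α-1} (`gap_lower_bound`), so S_q, read as the integral of a
step function on [0,1], is dominated by t^{-q(α-1)} + (1-t)^{-q(α-1)}. This is integrable when
q(α-1) < 1, and dominated convergence gives the limit (`tendsto_S_integral`); the thresholds 2 and
3/2 are the cases q = 1, 2. For α > 3/2 the term k = 1 alone makes S_2 diverge
(`tendsto_S_two_atTop`), while Cauchy-Schwarz on a thin set of edge modes shows S_1 = o(√S_2)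
(`S_one_le_add`).

For the search, let A be the search Hamiltonian with energies measured from the top of γH, and take
γ to be the mean of the inverse gaps. If u has Fourier coefficients b_k = 1/(γ gap_k), with b_0 = 0,
then A s = w/√n, A u = s/√n, and A(s + y/√n) = (F_n/√n) u + s/n for an explicit y
(`twoLevel_search`). So s and u span an almost invariant plane, in which s rotates with frequency
√(F_n/n) and reaches -i√F_n u at time T_n; since ⟨w,u⟩ = 1, the amplitude there is close to -i√F_n.
The error is controlled by Duhamel's formula (`norm_evolution_sub_le`) in terms of ‖y‖/√n, which
vanishes for α < 3/2 because ‖y‖²/n is bounded by multiples of 1/n and n^{2α-3}.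

The upper bound for all times needs no spectral analysis: with s' = s + y/√n and w = √n A s, moving
A across the inner product gives |⟨w, e^{-itA} s'⟩| ≤ √n ‖A s'‖ ≤ √F_n + 1/√n. The closed formulas
for the approximated sums follow from cancelling prefactors and letting negative powers of n vanish.
-/

namespace LongRangeSearch

/-! ### Bounds on the spectral gaps. -/

/-- The gap between the largest eigenvalue and the one at wave number `k`. -/
noncomputable def gap (α : ℝ) (n k : ℕ) : ℝ := eigenvalue α n n - eigenvalue α n k

theorem gap_eq (α : ℝ) {n : ℕ} (hn : n ≠ 0) (k : ℕ) :
    gap α n k = 2 * ∑ j ∈ Finset.Ico 1 n,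
      1 / (j : ℝ) ^ α * (1 - Real.cos (2 * Real.pi * k * j / n)) := by
  have hn' : (n : ℝ) ≠ 0 := by exact_mod_cast hn
  unfold gap eigenvalue
  rw [← mul_sub, ← Finset.sum_sub_distrib]
  congr 1
  refine Finset.sum_congr rfl fun j _ => ?_
  have : 2 * Real.pi * n * j / n = j * (2 * Real.pi) := by field_simp
  rw [this, Real.cos_nat_mul_two_pi]
  ring

theorem gap_nonneg (α : ℝ) (n k : ℕ) : 0 ≤ gap α n k := by
  rcases eq_or_ne n 0 with rfl | hn
  · simp [gap, eigenvalue]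
  rw [gap_eq α hn]
  refine mul_nonneg zero_le_two (Finset.sum_nonneg fun j _ => mul_nonneg (by positivity) ?_)
  linarith [Real.cos_le_one (2 * Real.pi * k * j / n)]

theorem gap_reflect (α : ℝ) {n k : ℕ} (hn : n ≠ 0) (hk : k ≤ n) :
    gap α n (n - k) = gap α n k := by
  have hn' : (n : ℝ) ≠ 0 := by exact_mod_cast hn
  rw [gap_eq α hn, gap_eq α hn]
  congr 1
  refine Finset.sum_congr rfl fun j _ => ?_
  have : 2 * Real.pi * ((n - k : ℕ) : ℝ) * j / n = j * (2 * Real.pi) - 2 * Real.pi * k * j / n := by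
    rw [Nat.cast_sub hk]; field_simp
  rw [this, Real.cos_nat_mul_two_pi_sub]

/-- The term j = 0 of the series is 1/0 = 0, so the series is ζ(α). -/
theorem sum_one_div_rpow_le_tsum {α : ℝ} (hα : 1 < α) (s : Finset ℕ) :
    ∑ j ∈ s, 1 / (j : ℝ) ^ α ≤ ∑' j : ℕ, 1 / (j : ℝ) ^ α :=
  (Real.summable_one_div_nat_rpow.2 hα).sum_le_tsum _ fun _ _ => by positivity

theorem gap_le_tsum {α : ℝ} (hα : 1 < α) (n k : ℕ) :
    gap α n k ≤ 4 * ∑' j : ℕ, 1 / (j : ℝ) ^ α := by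
  rcases eq_or_ne n 0 with rfl | hn
  · simp only [gap, eigenvalue, zero_le, Finset.Ico_eq_empty_of_le, Finset.sum_empty, mul_zero,
      sub_self]
    exact mul_nonneg (by norm_num) (tsum_nonneg fun _ => by positivity)
  rw [gap_eq α hn]
  calc _ ≤ 2 * ∑ j ∈ Finset.Ico 1 n, 1 / (j : ℝ) ^ α * 2 := by
        gcongr with j
        linarith [Real.neg_one_le_cos (2 * Real.pi * k * j / n)]
    _ = 4 * ∑ j ∈ Finset.Ico 1 n, 1 / (j : ℝ) ^ α := by rw [← Finset.sum_mul]; ring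
    _ ≤ _ := by gcongr; exact sum_one_div_rpow_le_tsum hα _

theorem eight_mul_sq_le_one_sub_cos {x : ℝ} (h0 : 0 ≤ x) (h1 : x ≤ 1 / 2) :
    8 * x ^ 2 ≤ 1 - Real.cos (2 * Real.pi * x) := by
  have hpi := Real.pi_pos
  have h := Real.cos_le_one_sub_mul_cos_sq (x := 2 * Real.pi * x)
    (abs_le.2 ⟨by nlinarith, by nlinarith⟩)
  have h2 : 2 / Real.pi ^ 2 * (2 * Real.pi * x) ^ 2 = 8 * x ^ 2 := by field_simp; ring
  linarith

theorem gap_lower_bound_of_two_mul_le {α : ℝ} (hα : 1 < α) {n k : ℕ} (hk : 1 ≤ k)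
    (hkn : 2 * k ≤ n) : (1 / 2) * (2 * (k / n : ℝ)) ^ (α - 1) ≤ gap α n k := by
  have hn : n ≠ 0 := by omega
  have hn' : (0 : ℝ) < n := by exact_mod_cast Nat.pos_of_ne_zero hn
  have hk' : (0 : ℝ) < k := by exact_mod_cast hk
  set x : ℝ := k / n with hx
  have hx0 : 0 < x := by positivity
  -- Only j ≤ m is kept, so that jx ≤ 1/2 and the quadratic bound on the cosine applies. Rounding
  -- down costs at most a factor 2: 1/2 ≤ m · 2x ≤ 1.
  set m : ℕ := n / (2 * k) with hm
  have hm1 : 1 ≤ m := (Nat.one_le_div_iff (by omega)).2 hkn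
  have hmn : m + 1 ≤ n := by
    have : m ≤ n / 2 := Nat.div_le_div_left (by omega) (by norm_num)
    omega
  have hmx : (m : ℝ) * (2 * x) ≤ 1 := by
    have h : m * (2 * k) ≤ n := Nat.div_mul_le_self _ _
    have h' : (m : ℝ) * (2 * k) ≤ n := by exact_mod_cast h
    rw [hx, mul_div_assoc', mul_div_assoc', div_le_one hn']
    exact h'
  have hmx' : 1 ≤ (m : ℝ) * (4 * x) := by
    have h : n < (m + 1) * (2 * k) := by
      rw [mul_comm]; exact Nat.lt_mul_div_succ n (by omega)
    have h2 : n ≤ m * (4 * k) := by nlinarith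
    have h' : (n : ℝ) ≤ m * (4 * k) := by exact_mod_cast h2
    rw [hx, mul_div_assoc', mul_div_assoc', one_le_div hn']
    exact h'
  have hm0 : (0 : ℝ) < m := by exact_mod_cast hm1
  -- Writing j^{2-α} as j · j^{-(α-1)} and using j · 2x ≤ 1 on the second factor leaves a sum of j,
  -- with no distinction between α < 2 and α ≥ 2.
  have hterm : ∀ j ∈ Finset.Ico 1 (m + 1), (2 * x) ^ (α - 1) * (8 * x ^ 2) * j ≤
      1 / (j : ℝ) ^ α * (1 - Real.cos (2 * Real.pi * k * j / n)) := by
    intro j hj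
    rw [Finset.mem_Ico] at hj
    have hj0 : (0 : ℝ) < j := by exact_mod_cast hj.1
    have hjm : (j : ℝ) ≤ m := by exact_mod_cast Nat.lt_succ_iff.1 hj.2
    have hjx : (j : ℝ) * (2 * x) ≤ 1 := le_trans (by gcongr) hmx
    have h1 := eight_mul_sq_le_one_sub_cos (x := j * x) (by positivity) (by linarith)
    have h2 : 2 * Real.pi * (j * x) = 2 * Real.pi * k * j / n := by rw [hx]; ring
    rw [h2] at h1
    have h3 : (j : ℝ) ^ α = j * j ^ (α - 1) := by
      rw [← Real.rpow_one_add' hj0.le (by linarith)]; congr 1; ring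
    have h4 : (j : ℝ) ^ (α - 1) * (2 * x) ^ (α - 1) ≤ 1 := by
      rw [← Real.mul_rpow hj0.le (by positivity)]
      exact Real.rpow_le_one (by positivity) hjx (by linarith)
    calc (2 * x) ^ (α - 1) * (8 * x ^ 2) * j ≤ 1 / (j : ℝ) ^ (α - 1) * (8 * x ^ 2) * j := by
          gcongr
          rw [le_div_iff₀ (by positivity)]
          linarith
      _ = 1 / (j : ℝ) ^ α * (8 * (j * x) ^ 2) := by rw [h3]; field_simp
      _ ≤ _ := by gcongr
  have hsum : (m : ℝ) ^ 2 / 2 ≤ ∑ j ∈ Finset.Ico 1 (m + 1), (j : ℝ) := by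
    have h := Finset.sum_range_id_mul_two (m + 1)
    have h2 : ((∑ j ∈ Finset.range (m + 1), j : ℕ) : ℝ) * 2 = (m + 1) * m := by
      exact_mod_cast h
    rw [Finset.range_eq_Ico, Finset.sum_eq_sum_Ico_succ_bot (by omega)] at h2
    push_cast at h2
    simp only [zero_add] at h2
    nlinarith
  rw [gap_eq α hn]
  calc (1 / 2) * (2 * x) ^ (α - 1) ≤ 2 * ((2 * x) ^ (α - 1) * (8 * x ^ 2) * (m ^ 2 / 2)) := by
        have : 1 ≤ ((m : ℝ) * (4 * x)) ^ 2 := one_le_pow₀ hmx'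
        have h0 : 0 ≤ (2 * x) ^ (α - 1) := by positivity
        nlinarith
    _ ≤ 2 * ∑ j ∈ Finset.Ico 1 (m + 1), (2 * x) ^ (α - 1) * (8 * x ^ 2) * j := by
        rw [← Finset.mul_sum]; gcongr
    _ ≤ 2 * ∑ j ∈ Finset.Ico 1 (m + 1), 1 / (j : ℝ) ^ α *
          (1 - Real.cos (2 * Real.pi * k * j / n)) := by
        exact mul_le_mul_of_nonneg_left (Finset.sum_le_sum hterm) zero_le_two
    _ ≤ _ := by
        refine mul_le_mul_of_nonneg_left ?_ zero_le_two
        refine Finset.sum_le_sum_of_subset_of_nonneg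
          (Finset.Ico_subset_Ico_right hmn) fun j _ _ => mul_nonneg (by positivity) ?_
        linarith [Real.cos_le_one (2 * Real.pi * k * j / n)]

/-- The gap is at least of order `min (k / n, 1 - k / n) ^ (α - 1)`. -/
theorem gap_lower_bound {α : ℝ} (hα : 1 < α) {n k : ℕ} (hk : 1 ≤ k) (hkn : k < n) :
    (1 / 2) * (2 * min (k / n : ℝ) (1 - k / n)) ^ (α - 1) ≤ gap α n k := by
  have hn' : (0 : ℝ) < n := by exact_mod_cast (by omega : 0 < n)
  have hmin : 0 ≤ min (k / n : ℝ) (1 - k / n) :=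
    le_min (by positivity) (sub_nonneg.2 ((div_le_one hn').2 (by exact_mod_cast hkn.le)))
  have h1 : 0 ≤ α - 1 := by linarith
  rcases le_total (2 * k) n with h | h
  · refine le_trans ?_ (gap_lower_bound_of_two_mul_le hα hk h)
    gcongr
    exact min_le_left _ _
  · rw [← gap_reflect α (by omega) hkn.le]
    refine le_trans ?_ (gap_lower_bound_of_two_mul_le hα (k := n - k) (by omega) (by omega))
    gcongr
    refine (min_le_right _ _).trans_eq ?_
    rw [Nat.cast_sub hkn.le]; field_simp

theorem gap_pos {α : ℝ} (hα : 1 < α) {n k : ℕ} (hk : 1 ≤ k) (hkn : k < n) : 0 < gap α n k := by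
  have hn' : (0 : ℝ) < n := by exact_mod_cast (by omega : 0 < n)
  refine lt_of_lt_of_le ?_ (gap_lower_bound hα hk hkn)
  have : 0 < min (k / n : ℝ) (1 - k / n) :=
    lt_min (by have : (0 : ℝ) < k := by exact_mod_cast hk
               positivity) (sub_pos.2 ((div_lt_one hn').2 (by exact_mod_cast hkn)))
  positivity

theorem gap_half_pos {α : ℝ} (hα : 1 < α) {n : ℕ} (hn : 2 ≤ n) : 0 < gap α n (n / 2) :=
  gap_pos hα (by omega) (by omega)

theorem S_eq_gap {α : ℝ} {n : ℕ} (h : gap α n (n / 2) ≠ 0) (q : ℕ) :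
    S q α n = 1 / (n : ℝ) * ∑ k ∈ Finset.Ico 1 n, (gap α n (n / 2) / gap α n k) ^ q := by
  unfold S
  congr 1
  refine Finset.sum_congr rfl fun k _ => ?_
  have : 1 - rescaledEigenvalue α n k = gap α n k / gap α n (n / 2) := by
    rw [rescaledEigenvalue, eq_div_iff h, sub_mul]
    change 1 * gap α n (n / 2) - (_ / gap α n (n / 2)) * _ = _
    rw [div_mul_cancel₀ _ h]
    simp only [gap]; ring
  rw [this, ← inv_div (gap α n k), inv_pow, one_div]

/-! ### Convergence of S_q to an integral over relative wave numbers. -/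

/-- The gap at relative wave number `x` in the limit of an infinite chain. -/
noncomputable def limitGap (α x : ℝ) : ℝ :=
  2 * ∑' j : ℕ, 1 / (j : ℝ) ^ α * (1 - Real.cos (2 * Real.pi * x * j))

/-- Dominated convergence for series, with majorant 2 j^{-α}; each fixed j eventually lies in the
range of summation. -/
theorem tendsto_gap {α : ℝ} (hα : 1 < α) {k : ℕ → ℕ} {x : ℝ}
    (hk : Tendsto (fun n : ℕ => (k n : ℝ) / n) atTop (𝓝 x)) :
    Tendsto (fun n : ℕ => gap α n (k n)) atTop (𝓝 (limitGap α x)) := by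
  have hsum := Real.summable_one_div_nat_rpow.2 hα
  have key : Tendsto (fun n : ℕ => ∑' j : ℕ, (if j ∈ Finset.Ico 1 n then
      1 / (j : ℝ) ^ α * (1 - Real.cos (2 * Real.pi * ((k n : ℝ) / n) * j)) else 0)) atTop
      (𝓝 (∑' j : ℕ, 1 / (j : ℝ) ^ α * (1 - Real.cos (2 * Real.pi * x * j)))) := by
    refine tendsto_tsum_of_dominated_convergence (hsum.mul_right 2) (fun j => ?_)
      (Eventually.of_forall fun n j => ?_)
    · rcases Nat.eq_zero_or_pos j with rfl | hj
      · simp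
      · have : Tendsto (fun n : ℕ => 1 / (j : ℝ) ^ α *
            (1 - Real.cos (2 * Real.pi * ((k n : ℝ) / n) * j))) atTop
            (𝓝 (1 / (j : ℝ) ^ α * (1 - Real.cos (2 * Real.pi * x * j)))) := by
          have hc : Continuous fun y : ℝ => 1 / (j : ℝ) ^ α *
            (1 - Real.cos (2 * Real.pi * y * j)) := by fun_prop
          exact (hc.tendsto x).comp hk
        refine this.congr' ?_
        filter_upwards [eventually_gt_atTop j] with n hn
        rw [if_pos (Finset.mem_Ico.2 ⟨hj, hn⟩)]
    · split_ifs
      · have h1 := Real.cos_le_one (2 * Real.pi * ((k n : ℝ) / n) * j)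
        have h2 := Real.neg_one_le_cos (2 * Real.pi * ((k n : ℝ) / n) * j)
        rw [norm_mul, Real.norm_of_nonneg (by positivity : (0 : ℝ) ≤ 1 / (j : ℝ) ^ α),
          Real.norm_of_nonneg (by linarith)]
        gcongr
        linarith
      · simp only [norm_zero]; positivity
  refine (key.const_mul 2).congr' ?_
  filter_upwards [eventually_ne_atTop 0] with n hn
  rw [gap_eq α hn, tsum_eq_sum (s := Finset.Ico 1 n) fun j hj => if_neg hj]
  congr 1
  refine Finset.sum_congr rfl fun j hj => ?_
  rw [if_pos hj]
  have : 2 * Real.pi * ((k n : ℝ) / n) * j = 2 * Real.pi * k n * j / n := by ring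
  rw [this]

/-- All terms are nonnegative, and the one at j = 1 is positive because x is not an integer. -/
theorem limitGap_pos {α : ℝ} (hα : 1 < α) {x : ℝ} (h0 : 0 < x) (h1 : x < 1) :
    0 < limitGap α x := by
  have hnn : ∀ j : ℕ, 0 ≤ 1 / (j : ℝ) ^ α * (1 - Real.cos (2 * Real.pi * x * j)) := fun j =>
    mul_nonneg (by positivity) (by linarith [Real.cos_le_one (2 * Real.pi * x * j)])
  have hs : Summable fun j : ℕ => 1 / (j : ℝ) ^ α * (1 - Real.cos (2 * Real.pi * x * j)) := by
    refine Summable.of_nonneg_of_le hnn (fun j => ?_)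
      ((Real.summable_one_div_nat_rpow.2 hα).mul_right 2)
    gcongr
    linarith [Real.neg_one_le_cos (2 * Real.pi * x * j)]
  refine mul_pos two_pos (hs.tsum_pos hnn 1 ?_)
  have hpi := Real.pi_pos
  have : Real.cos (2 * Real.pi * x) ≠ 1 := by
    intro h
    rw [Real.cos_eq_one_iff_of_lt_of_lt (by nlinarith) (by nlinarith)] at h
    have : 0 < 2 * Real.pi * x := by positivity
    linarith
  have h2 := lt_of_le_of_ne (Real.cos_le_one _) this
  simp only [Nat.cast_one, Real.one_rpow, mul_one, div_one, one_mul]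
  linarith

theorem tendsto_nat_half_div : Tendsto (fun n : ℕ => ((n / 2 : ℕ) : ℝ) / n) atTop (𝓝 (1 / 2)) := by
  have := tendsto_nat_floor_mul_div_atTop (R := ℝ) (a := 1 / 2) (by norm_num)
  have h2 := this.comp tendsto_natCast_atTop_atTop
  refine h2.congr fun n => ?_
  simp only [Function.comp]
  congr 2
  rw [one_div_mul_eq_div]
  exact Nat.floor_div_ofNat (n : ℝ) 2 |>.trans (by simp)

theorem tendsto_gap_half {α : ℝ} (hα : 1 < α) :
    Tendsto (fun n : ℕ => gap α n (n / 2)) atTop (𝓝 (limitGap α (1 / 2))) :=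
  tendsto_gap hα tendsto_nat_half_div

/-- Turns a Riemann sum into the integral of a step function, so that dominated convergence on [0,1]
applies. The floor equals k on [k, k+1) only, hence the right endpoint is discarded as a null set.
-/
theorem integral_comp_natFloor_mul (h : ℕ → ℝ) {n : ℕ} (hn : n ≠ 0) :
    ∫ t in (0 : ℝ)..1, h ⌊(n : ℝ) * t⌋₊ = 1 / (n : ℝ) * ∑ k ∈ Finset.range n, h k := by
  have hn' : (n : ℝ) ≠ 0 := by exact_mod_cast hn
  have hae : ∀ k : ℕ, ∀ᵐ x : ℝ, x ∈ Set.uIoc (k : ℝ) ((k + 1 : ℕ) : ℝ) → h k = h ⌊x⌋₊ := by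
    intro k
    filter_upwards [MeasureTheory.Measure.ae_ne MeasureTheory.volume ((k + 1 : ℕ) : ℝ)] with x hx hxI
    rw [Set.uIoc_of_le (by push_cast; linarith)] at hxI
    congr 1
    symm
    rw [Nat.floor_eq_iff (le_trans (Nat.cast_nonneg k) hxI.1.le)]
    refine ⟨hxI.1.le, ?_⟩
    have := lt_of_le_of_ne hxI.2 hx
    push_cast at this
    exact this
  have h1 : ∑ k ∈ Finset.range n, ∫ x in (k : ℝ)..((k + 1 : ℕ) : ℝ), h ⌊x⌋₊ =
      ∫ x in ((0 : ℕ) : ℝ)..(n : ℝ), h ⌊x⌋₊ :=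
    intervalIntegral.sum_integral_adjacent_intervals (a := fun k : ℕ => (k : ℝ)) fun k _ =>
      (intervalIntegrable_const (c := h k)).congr_ae
        ((MeasureTheory.ae_restrict_iff' measurableSet_uIoc).2 (hae k))
  have h2 : ∀ k : ℕ, ∫ x in (k : ℝ)..((k + 1 : ℕ) : ℝ), h ⌊x⌋₊ = h k := by
    intro k
    rw [← intervalIntegral.integral_congr_ae (hae k)]
    simp
  rw [intervalIntegral.integral_comp_mul_left (fun x => h ⌊x⌋₊) hn', mul_zero, mul_one,
    smul_eq_mul, one_div, ← Finset.sum_congr rfl fun k _ => h2 k, h1, Nat.cast_zero]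

/-- The summand of `S`, extended by zero. -/
noncomputable def term (q : ℕ) (α : ℝ) (n k : ℕ) : ℝ :=
  if k ∈ Finset.Ico 1 n then (gap α n (n / 2) / gap α n k) ^ q else 0

theorem term_nonneg (q : ℕ) (α : ℝ) (n k : ℕ) : 0 ≤ term q α n k := by
  unfold term
  split_ifs
  · exact pow_nonneg (div_nonneg (gap_nonneg _ _ _) (gap_nonneg _ _ _)) _
  · exact le_rfl

theorem S_eq_sum_term {α : ℝ} (hα : 1 < α) {n : ℕ} (hn : 2 ≤ n) (q : ℕ) :
    S q α n = 1 / (n : ℝ) * ∑ k ∈ Finset.range n, term q α n k := by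
  rw [S_eq_gap (gap_half_pos hα hn).ne']
  congr 1
  rw [Finset.range_eq_Ico, Finset.sum_eq_sum_Ico_succ_bot (a := 0) (by omega)]
  have h0 : term q α n 0 = 0 := if_neg (by simp)
  rw [h0, zero_add, zero_add]
  exact Finset.sum_congr rfl fun k hk => (if_pos hk).symm

/-- The integrable majorant: the gap at n/2 is at most 4ζ(α), the gap at k is at least of order
min(t, 1-t)^{α-1}, and the power of the minimum is at most the sum of both powers. -/
theorem term_floor_le {α : ℝ} (hα : 1 < α) (q n : ℕ) {t : ℝ} (h0 : 0 < t) (h1 : t < 1) :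
    term q α n ⌊(n : ℝ) * t⌋₊ ≤ (8 * ∑' j : ℕ, 1 / (j : ℝ) ^ α) ^ q *
      (t ^ (-(q * (α - 1))) + (1 - t) ^ (-(q * (α - 1)))) := by
  have hG : 0 ≤ ∑' j : ℕ, 1 / (j : ℝ) ^ α := tsum_nonneg fun _ => by positivity
  have h1' : 0 < 1 - t := by linarith
  unfold term
  split_ifs with hk
  · set k := ⌊(n : ℝ) * t⌋₊
    rw [Finset.mem_Ico] at hk
    have hn : (0 : ℝ) < n := by exact_mod_cast (by omega : 0 < n)
    have hk1 : (1 : ℝ) ≤ k := by exact_mod_cast hk.1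
    have hfl : (k : ℝ) ≤ n * t := Nat.floor_le (by positivity)
    have hfu : (n : ℝ) * t < k + 1 := Nat.lt_floor_add_one _
    -- Since k ≥ 1, nt < k + 1 ≤ 2k; on the other side k/n ≤ t suffices.
    have hm : min t (1 - t) ≤ 2 * min (k / n : ℝ) (1 - k / n) := by
      rw [mul_min_of_nonneg _ _ zero_le_two]
      refine min_le_min ?_ ?_
      · rw [mul_div_assoc', le_div_iff₀ hn]; nlinarith
      · have : (k : ℝ) / n ≤ t := by rw [div_le_iff₀ hn]; linarith
        linarith
    have hmp : 0 < min t (1 - t) := lt_min h0 h1'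
    have hg : (1 / 2) * min t (1 - t) ^ (α - 1) ≤ gap α n k := by
      refine le_trans ?_ (gap_lower_bound hα hk.1 hk.2)
      have : 0 ≤ α - 1 := by linarith
      gcongr
    have hq : min t (1 - t) ^ (-(q * (α - 1))) ≤
        t ^ (-(q * (α - 1))) + (1 - t) ^ (-(q * (α - 1))) := by
      have e1 : 0 ≤ t ^ (-(q * (α - 1))) := by positivity
      have e2 : 0 ≤ (1 - t) ^ (-(q * (α - 1))) := by positivity
      rcases min_choice t (1 - t) with h | h <;> rw [h] <;> linarith
    calc (gap α n (n / 2) / gap α n k) ^ q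
        ≤ ((4 * ∑' j : ℕ, 1 / (j : ℝ) ^ α) / ((1 / 2) * min t (1 - t) ^ (α - 1))) ^ q := by
          have := gap_nonneg α n (n / 2)
          have := gap_nonneg α n k
          gcongr
          exact gap_le_tsum hα _ _
      _ = (8 * ∑' j : ℕ, 1 / (j : ℝ) ^ α) ^ q * min t (1 - t) ^ (-(q * (α - 1))) := by
          rw [Real.rpow_neg hmp.le, mul_comm (q : ℝ), Real.rpow_mul hmp.le, Real.rpow_natCast,
            ← inv_pow, ← mul_pow]
          congr 1
          have : min t (1 - t) ^ (α - 1) ≠ 0 := by positivity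
          field_simp
          ring
      _ ≤ _ := by gcongr
  · positivity

theorem tendsto_term_floor {α : ℝ} (hα : 1 < α) (q : ℕ) {t : ℝ} (h0 : 0 < t) (h1 : t < 1) :
    Tendsto (fun n : ℕ => term q α n ⌊(n : ℝ) * t⌋₊) atTop
      (𝓝 ((limitGap α (1 / 2) / limitGap α t) ^ q)) := by
  have hk : Tendsto (fun n : ℕ => (⌊(n : ℝ) * t⌋₊ : ℝ) / n) atTop (𝓝 t) := by
    refine ((tendsto_nat_floor_mul_div_atTop (R := ℝ) h0.le).comp
      tendsto_natCast_atTop_atTop).congr fun n => ?_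
    simp only [Function.comp, mul_comm t]
  have := ((tendsto_gap_half hα).div (tendsto_gap hα hk) (limitGap_pos hα h0 h1).ne').pow q
  refine this.congr' ?_
  obtain ⟨N, hN⟩ := exists_nat_gt (1 / t)
  filter_upwards [eventually_ge_atTop N, eventually_gt_atTop 0] with n hn hn0
  have hn' : (0 : ℝ) < n := by exact_mod_cast hn0
  have hNn : (N : ℝ) ≤ n := by exact_mod_cast hn
  rw [term, if_pos]
  · rfl
  rw [Finset.mem_Ico]
  constructor
  · rw [Nat.one_le_floor_iff]
    rw [div_lt_iff₀ h0] at hN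
    nlinarith
  · rw [Nat.floor_lt (by positivity)]
    nlinarith

theorem tendsto_S_integral {α : ℝ} (hα : 1 < α) (q : ℕ) (hq : q * (α - 1) < 1) :
    Tendsto (fun n : ℕ => S q α n) atTop
      (𝓝 (∫ t in (0 : ℝ)..1, (limitGap α (1 / 2) / limitGap α t) ^ q)) := by
  have key : Tendsto (fun n : ℕ => ∫ t in (0 : ℝ)..1, term q α n ⌊(n : ℝ) * t⌋₊) atTop
      (𝓝 (∫ t in (0 : ℝ)..1, (limitGap α (1 / 2) / limitGap α t) ^ q)) := by
    have hae : ∀ᵐ t : ℝ, t ∈ Set.uIoc (0 : ℝ) 1 → 0 < t ∧ t < 1 := by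
      filter_upwards [MeasureTheory.Measure.ae_ne MeasureTheory.volume (1 : ℝ)] with t ht htI
      rw [Set.uIoc_of_le zero_le_one] at htI
      exact ⟨htI.1, lt_of_le_of_ne htI.2 ht⟩
    refine intervalIntegral.tendsto_integral_filter_of_dominated_convergence
      (fun t => (8 * ∑' j : ℕ, 1 / (j : ℝ) ^ α) ^ q *
        (t ^ (-(q * (α - 1))) + (1 - t) ^ (-(q * (α - 1))))) ?_ ?_ ?_ ?_
    · refine Eventually.of_forall fun n => Measurable.aestronglyMeasurable ?_
      exact (measurable_from_nat (f := term q α n)).comp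
        (Nat.measurable_floor.comp (measurable_const.mul measurable_id))
    · refine Eventually.of_forall fun n => ?_
      filter_upwards [hae] with t ht htI
      rw [Real.norm_of_nonneg (term_nonneg _ _ _ _)]
      exact term_floor_le hα q n (ht htI).1 (ht htI).2
    · have h1 : IntervalIntegrable (fun t : ℝ => t ^ (-(q * (α - 1)))) MeasureTheory.volume 0 1 :=
        intervalIntegral.intervalIntegrable_rpow' (by linarith)
      have h2 := (h1.comp_sub_left 1).symm
      rw [sub_zero, sub_self] at h2
      exact (h1.add h2).const_mul _
    · filter_upwards [hae] with t ht htI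
      exact tendsto_term_floor hα q (ht htI).1 (ht htI).2
  refine key.congr' ?_
  filter_upwards [eventually_ge_atTop 2] with n hn
  rw [integral_comp_natFloor_mul _ (by omega), S_eq_sum_term hα hn]

theorem tsum_one_div_rpow_pos {α : ℝ} (hα : 1 < α) : 0 < ∑' j : ℕ, 1 / (j : ℝ) ^ α :=
  (Real.summable_one_div_nat_rpow.2 hα).tsum_pos (fun _ => by positivity) 1 (by simp)

/-- Every summand is bounded below by a constant, and at least n/2 of them are present. This makes
the limit positive without examining the limiting integral. -/
theorem eventually_S_lower_bound {α : ℝ} (hα : 1 < α) (q : ℕ) :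
    ∃ c : ℝ, 0 < c ∧ ∀ᶠ n : ℕ in atTop, c ≤ S q α n := by
  have hG := tsum_one_div_rpow_pos hα
  have hL := limitGap_pos hα (x := 1 / 2) (by norm_num) (by norm_num)
  set G := ∑' j : ℕ, 1 / (j : ℝ) ^ α
  set c : ℝ := (limitGap α (1 / 2) / 2 / (4 * G)) ^ q with hc
  have hc0 : 0 < c := by positivity
  refine ⟨c / 2, by positivity, ?_⟩
  filter_upwards [eventually_ge_atTop 2,
    (tendsto_gap_half hα).eventually_const_le (half_lt_self hL)] with n hn hgap
  have hn' : (2 : ℝ) ≤ n := by exact_mod_cast hn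
  rw [S_eq_gap (gap_half_pos hα hn).ne']
  calc c / 2 ≤ 1 / (n : ℝ) * ∑ k ∈ Finset.Ico 1 n, c := by
        rw [Finset.sum_const, Nat.card_Ico, nsmul_eq_mul, Nat.cast_sub (by omega), Nat.cast_one,
          one_div_mul_eq_div, div_le_div_iff₀ (by norm_num) (by linarith)]
        nlinarith
    _ ≤ _ := by
        refine mul_le_mul_of_nonneg_left (Finset.sum_le_sum fun k hk => ?_) (by positivity)
        rw [Finset.mem_Ico] at hk
        have h1 := gap_pos hα hk.1 hk.2
        rw [hc]
        gcongr
        · exact gap_nonneg _ _ _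
        · exact gap_le_tsum hα n k

theorem exists_tendsto_S {α : ℝ} (hα : 1 < α) (q : ℕ) (hq : q * (α - 1) < 1) :
    ∃ s : ℝ, 0 < s ∧ Tendsto (fun n : ℕ => S q α n) atTop (𝓝 s) := by
  obtain ⟨c, hc, h⟩ := eventually_S_lower_bound hα q
  exact ⟨_, hc.trans_le (ge_of_tendsto (tendsto_S_integral hα q hq) h), tendsto_S_integral hα q hq⟩

/-! ### The regime α > 3/2. -/

theorem one_sub_cos_le_two_mul_rpow {s x : ℝ} (hs0 : 0 < s) (hs : s ≤ 2) (hx : 0 ≤ x) :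
    1 - Real.cos x ≤ 2 * x ^ s := by
  rcases le_total x 1 with h | h
  · have h1 := Real.one_sub_sq_div_two_le_cos (x := x)
    rcases hx.eq_or_lt with rfl | hx'
    · simp [hs0.ne']
    have h2 : x ^ (2 : ℝ) ≤ x ^ s := Real.rpow_le_rpow_of_exponent_ge hx' h hs
    rw [Real.rpow_two] at h2
    nlinarith [sq_nonneg x]
  · have h1 := Real.one_le_rpow h hs0.le
    linarith [Real.neg_one_le_cos x]

/-- Trading only the power s of the cosine bound keeps ∑ j^{s-α} convergent. The exact decay rate of
the gap, which changes form at α = 3, is not needed. -/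
theorem gap_one_le {α s : ℝ} (hs0 : 0 < s) (hs : s ≤ 2) (hsα : s < α - 1) {n : ℕ} (hn : n ≠ 0) :
    gap α n 1 ≤ 4 * (2 * Real.pi) ^ s * (∑' j : ℕ, 1 / (j : ℝ) ^ (α - s)) * ((n : ℝ) ^ s)⁻¹ := by
  have hn' : (0 : ℝ) < n := by exact_mod_cast Nat.pos_of_ne_zero hn
  rw [gap_eq α hn]
  calc _ ≤ 2 * ∑ j ∈ Finset.Ico 1 n, 1 / (j : ℝ) ^ (α - s) *
        (2 * (2 * Real.pi) ^ s * ((n : ℝ) ^ s)⁻¹) := by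
        refine mul_le_mul_of_nonneg_left (Finset.sum_le_sum fun j hj => ?_) zero_le_two
        have hj0 : (0 : ℝ) < j := by exact_mod_cast (Finset.mem_Ico.1 hj).1
        have h := one_sub_cos_le_two_mul_rpow hs0 hs (x := 2 * Real.pi * (1 : ℕ) * j / n)
          (by positivity)
        refine (mul_le_mul_of_nonneg_left h (by positivity)).trans_eq ?_
        rw [Nat.cast_one, mul_one, Real.div_rpow (by positivity) hn'.le,
          Real.mul_rpow (by positivity) hj0.le, Real.rpow_sub hj0]
        field_simp
    _ = 4 * (2 * Real.pi) ^ s * (∑ j ∈ Finset.Ico 1 n, 1 / (j : ℝ) ^ (α - s)) *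
        ((n : ℝ) ^ s)⁻¹ := by rw [← Finset.sum_mul]; ring
    _ ≤ _ := by
        gcongr
        exact sum_one_div_rpow_le_tsum (by linarith) _

theorem tendsto_S_two_atTop {α : ℝ} (hα : 3 / 2 < α) :
    Tendsto (fun n : ℕ => S 2 α n) atTop atTop := by
  have hα1 : 1 < α := by linarith
  -- s > 1/2 makes the exponent 2s - 1 positive; s < α - 1 and s < 2 are what the bound on the gap
  -- at k = 1 requires.
  obtain ⟨s, hs, hs'⟩ := exists_between (lt_min (by linarith : 1 / 2 < α - 1)
    (by norm_num : (1 / 2 : ℝ) < 2))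
  obtain ⟨hsα, hs2⟩ := lt_min_iff.1 hs'
  have hL := limitGap_pos hα1 (x := 1 / 2) (by norm_num) (by norm_num)
  have hG := tsum_one_div_rpow_pos (α := α - s) (by linarith)
  set C : ℝ := 4 * (2 * Real.pi) ^ s * ∑' j : ℕ, 1 / (j : ℝ) ^ (α - s) with hC
  have hpi := Real.pi_pos
  have hC0 : 0 < C := by positivity
  set c : ℝ := (limitGap α (1 / 2) / 2 / C) ^ 2 with hc
  have hc0 : 0 < c := by positivity
  have hlim : Tendsto (fun n : ℕ => c * (n : ℝ) ^ (2 * s - 1)) atTop atTop :=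
    ((tendsto_rpow_atTop (by linarith)).comp tendsto_natCast_atTop_atTop).const_mul_atTop hc0
  refine tendsto_atTop_mono' _ ?_ hlim
  filter_upwards [eventually_ge_atTop 2,
    (tendsto_gap_half hα1).eventually_const_le (half_lt_self hL)] with n hn hgap
  have hn' : (0 : ℝ) < n := by exact_mod_cast (by omega : 0 < n)
  have h1 := gap_pos hα1 le_rfl (show 1 < n by omega)
  rw [S_eq_gap (gap_half_pos hα1 hn).ne']
  calc c * (n : ℝ) ^ (2 * s - 1)
      = 1 / (n : ℝ) * (limitGap α (1 / 2) / 2 / (C * ((n : ℝ) ^ s)⁻¹)) ^ 2 := by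
        rw [Real.rpow_sub hn', mul_comm 2 s, Real.rpow_mul hn'.le, Real.rpow_two, Real.rpow_one, hc]
        field_simp
    _ ≤ 1 / (n : ℝ) * (gap α n (n / 2) / gap α n 1) ^ 2 := by
        have := gap_nonneg α n (n / 2)
        gcongr
        exact gap_one_le (by linarith) hs2.le hsα (by omega)
    _ ≤ _ := by
        gcongr
        exact Finset.single_le_sum (f := fun k => (gap α n (n / 2) / gap α n k) ^ 2)
          (fun _ _ => sq_nonneg _) (Finset.mem_Ico.2 ⟨le_rfl, hn⟩)

/-- Splitting off the wave numbers within `m` of the band edge and applying Cauchy-Schwarz to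
them. -/
theorem S_one_le_add {α : ℝ} (hα : 1 < α) {δ : ℝ} (hδ : 0 < δ) {n : ℕ} (hn : 2 ≤ n) :
    S 1 α n ≤ (4 * ∑' j : ℕ, 1 / (j : ℝ) ^ α) / ((1 / 2) * (2 * δ) ^ (α - 1)) +
      √(2 * (⌈δ * n⌉₊ : ℝ) / n) * √(S 2 α n) := by
  have hn' : (0 : ℝ) < n := by exact_mod_cast (by omega : 0 < n)
  set m := ⌈δ * n⌉₊ with hm
  set M := (4 * ∑' j : ℕ, 1 / (j : ℝ) ^ α) / ((1 / 2) * (2 * δ) ^ (α - 1)) with hM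
  have hG := tsum_one_div_rpow_pos hα
  have hM0 : 0 < M := by positivity
  have hα1 : 0 ≤ α - 1 := by linarith
  set a : ℕ → ℝ := fun k => gap α n (n / 2) / gap α n k with ha
  have ha0 : ∀ k, 0 ≤ a k := fun k => div_nonneg (gap_nonneg _ _ _) (gap_nonneg _ _ _)
  set B := (Finset.Ico 1 n).filter fun k => k < m ∨ n - k < m with hB
  -- The edge modes lie in the first m wave numbers and their reflections under k ↦ n - k.
  have hcard : (B.card : ℝ) ≤ 2 * m := by
    have hsub : B ⊆ Finset.range m ∪ (Finset.range m).image (n - ·) := by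
      intro k hk
      rw [hB, Finset.mem_filter, Finset.mem_Ico] at hk
      rw [Finset.mem_union, Finset.mem_range, Finset.mem_image]
      rcases hk.2 with h | h
      · exact Or.inl h
      · exact Or.inr ⟨n - k, Finset.mem_range.2 h, by omega⟩
    have h1 := (Finset.card_le_card hsub).trans (Finset.card_union_le _ _)
    have h2 := (Finset.range m).card_image_le (f := (n - ·))
    rw [Finset.card_range] at h1 h2
    exact_mod_cast (by omega : B.card ≤ 2 * m)
  have hS2 : S 2 α n = 1 / (n : ℝ) * ∑ k ∈ Finset.Ico 1 n, a k ^ 2 :=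
    S_eq_gap (gap_half_pos hα hn).ne' 2
  have hbulk : ∑ k ∈ (Finset.Ico 1 n).filter (fun k => ¬ (k < m ∨ n - k < m)), a k ≤ n * M := by
    calc _ ≤ ∑ k ∈ (Finset.Ico 1 n).filter (fun k => ¬ (k < m ∨ n - k < m)), M := by
          refine Finset.sum_le_sum fun k hk => ?_
          rw [Finset.mem_filter, Finset.mem_Ico] at hk
          obtain ⟨⟨hk1, hkn⟩, hk2⟩ := hk
          push Not at hk2
          have hδk : δ ≤ min (k / n : ℝ) (1 - k / n) := by
            have e1 : δ * n ≤ k := Nat.ceil_le.1 hk2.1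
            have e2 : δ * n ≤ ((n - k : ℕ) : ℝ) := Nat.ceil_le.1 hk2.2
            rw [Nat.cast_sub hkn.le] at e2
            refine le_min ((le_div_iff₀ hn').2 e1) ?_
            rw [le_sub_iff_add_le, ← le_sub_iff_add_le', div_le_iff₀ hn']
            linarith
          have hg := gap_lower_bound hα hk1 hkn
          rw [hM]
          refine div_le_div₀ (by positivity) (gap_le_tsum hα _ _) (by positivity)
            (le_trans ?_ hg)
          gcongr
      _ ≤ n * M := by
          rw [Finset.sum_const, nsmul_eq_mul]
          gcongr
          refine (Finset.card_filter_le _ _).trans ?_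
          rw [Nat.card_Ico]; omega
  have hedge : ∑ k ∈ B, a k ≤ n * (√(2 * (m : ℝ) / n) * √(S 2 α n)) := by
    refine (sq_le_sq₀ (Finset.sum_nonneg fun k _ => ha0 k) (by positivity)).1 ?_
    have hS20 : 0 ≤ S 2 α n := by rw [hS2]; positivity
    rw [mul_pow, mul_pow, Real.sq_sqrt (by positivity), Real.sq_sqrt hS20, hS2]
    calc (∑ k ∈ B, a k) ^ 2 ≤ B.card * ∑ k ∈ B, a k ^ 2 := sq_sum_le_card_mul_sum_sq
      _ ≤ 2 * m * ∑ k ∈ Finset.Ico 1 n, a k ^ 2 := by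
          gcongr
          exact Finset.filter_subset _ _
      _ = _ := by field_simp
  rw [S_eq_gap (gap_half_pos hα hn).ne', one_div_mul_eq_div, div_le_iff₀ hn']
  simp only [pow_one]
  rw [← Finset.sum_filter_add_sum_filter_not (Finset.Ico 1 n) (fun k => k < m ∨ n - k < m)]
  linarith [hbulk, hedge]

theorem tendsto_amplitude_zero {α : ℝ} (hα : 3 / 2 < α) :
    Tendsto (fun n : ℕ => amplitude α n) atTop (𝓝 0) := by
  have hα1 : 1 < α := by linarith
  have hS := tendsto_S_two_atTop hα
  have hsqrt : Tendsto (fun n : ℕ => √(S 2 α n)) atTop atTop := Real.tendsto_sqrt_atTop.comp hS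
  rw [Metric.tendsto_nhds]
  intro ε hε
  -- Once δn ≥ 1, ⌈δn⌉ ≤ 2δn, so the square-root factor is at most √(4δ) = ε/2.
  set δ : ℝ := ε ^ 2 / 16 with hδ
  have hδ0 : 0 < δ := by positivity
  set M := (4 * ∑' j : ℕ, 1 / (j : ℝ) ^ α) / ((1 / 2) * (2 * δ) ^ (α - 1)) with hM
  have hinv : Tendsto (fun n : ℕ => M / √(S 2 α n)) atTop (𝓝 0) := hsqrt.const_div_atTop M
  obtain ⟨N, hN⟩ := exists_nat_gt (1 / δ)
  filter_upwards [eventually_ge_atTop 2, eventually_ge_atTop N, hsqrt.eventually_gt_atTop 0,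
    hinv.eventually_lt_const (half_pos hε)] with n hn hnN hpos hMn
  have hn' : (0 : ℝ) < n := by exact_mod_cast (by omega : 0 < n)
  have hnN' : (N : ℝ) ≤ n := by exact_mod_cast hnN
  have hS1 : 0 ≤ S 1 α n := by
    rw [S_eq_sum_term hα1 hn]
    exact mul_nonneg (by positivity) (Finset.sum_nonneg fun _ _ => term_nonneg _ _ _ _)
  have h := S_one_le_add hα1 hδ0 hn
  have hceil : √(2 * (⌈δ * n⌉₊ : ℝ) / n) ≤ ε / 2 := by
    rw [Real.sqrt_le_left (by positivity), div_le_iff₀ hn']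
    have h1 := (Nat.ceil_lt_add_one (by positivity : 0 ≤ δ * n)).le
    rw [div_lt_iff₀ hδ0] at hN
    have h2 : 1 ≤ δ * n := by nlinarith
    have h3 : (ε / 2) ^ 2 = 4 * δ := by rw [hδ]; ring
    rw [h3]
    linarith
  rw [dist_zero_right, amplitude, Real.norm_of_nonneg (by positivity), div_lt_iff₀ hpos]
  rw [div_lt_iff₀ hpos] at hMn
  have := mul_le_mul_of_nonneg_right hceil hpos.le
  linarith

/-! ### The approximations of S_q and of the amplitude. -/

theorem zetaReal_pos {x : ℝ} (hx : 1 < x) : 0 < zetaReal x := by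
  have hs := Real.summable_one_div_nat_rpow.2 hx
  have h : riemannZeta (x : ℂ) = ((∑' n : ℕ, 1 / (n : ℝ) ^ x : ℝ) : ℂ) := by
    rw [zeta_eq_tsum_one_div_nat_cpow (by simpa using hx), Complex.ofReal_tsum]
    refine tsum_congr fun n => ?_
    rw [Complex.ofReal_div, Complex.ofReal_one, Complex.ofReal_cpow (Nat.cast_nonneg n),
      Complex.ofReal_natCast]
  rw [zetaReal, h, Complex.ofReal_re]
  exact hs.tsum_pos (fun _ => by positivity) 1 (by simp)

theorem fCoeff_pos {α : ℝ} (hα : 1 < α) : 0 < fCoeff α := by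
  have h : (2 : ℝ) ^ (2 - α) < 2 ^ (2 : ℝ) :=
    Real.rpow_lt_rpow_of_exponent_lt one_lt_two (by linarith)
  rw [Real.rpow_two] at h
  have := zetaReal_pos hα
  unfold fCoeff
  nlinarith

/-- Γ is negative on (-1, 0), by the functional equation from its positivity on (0, 1), and the sine
is positive on (0, π). -/
theorem gCoeff_pos {α : ℝ} (h1 : 1 < α) (h2 : α < 2) : 0 < gCoeff α := by
  have hpi := Real.pi_pos
  have hG : Real.Gamma (1 - α) < 0 := by
    have h := Real.Gamma_add_one (s := 1 - α) (by linarith)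
    have h3 : 0 < Real.Gamma (1 - α + 1) := Real.Gamma_pos_of_pos (by linarith)
    by_contra! hc
    nlinarith
  have hs : 0 < Real.sin (α * Real.pi / 2) :=
    Real.sin_pos_of_pos_of_lt_pi (by positivity) (by nlinarith)
  unfold gCoeff
  have : 0 < (2 : ℝ) ^ α * Real.pi ^ (α - 1) * Real.sin (α * Real.pi / 2) := by positivity
  nlinarith [mul_neg_of_pos_of_neg this hG]

theorem tendsto_natCast_rpow_mul_add {x : ℝ} (hx : x < 0) (a b : ℝ) :
    Tendsto (fun n : ℕ => (n : ℝ) ^ x * a + b) atTop (𝓝 b) := by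
  have h := (tendsto_rpow_neg_atTop (y := -x) (by linarith)).comp tendsto_natCast_atTop_atTop
  simpa [Function.comp_def] using (h.mul_const a).add_const b

theorem approxAmplitude_asymptotics {α : ℝ} (h1 : 1 < α) (h2 : α < 3 / 2) :
    (∀ᶠ n : ℕ in atTop, approxAmplitude α n ^ 2 =
      2 * ((n : ℝ) ^ (α - 2) * zetaReal (α - 1) + 2 ^ (α - 2) / (2 - α)) ^ 2 /
        ((n : ℝ) ^ (2 * α - 3) * zetaReal (2 * α - 2) + 2 ^ (2 * α - 3) / (3 - 2 * α))) ∧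
    Tendsto (fun n : ℕ => approxAmplitude α n) atTop (𝓝 (√(3 - 2 * α) / (2 - α))) ∧
    Tendsto (fun n : ℕ => approxAmplitude α n ^ 2) atTop (𝓝 ((3 - 2 * α) / (2 - α) ^ 2)) := by
  have hf := fCoeff_pos h1
  have hg := gCoeff_pos h1 (by linarith)
  have hA := tendsto_natCast_rpow_mul_add (x := α - 2) (by linarith) (zetaReal (α - 1))
    (2 ^ (α - 2) / (2 - α))
  have hB := tendsto_natCast_rpow_mul_add (x := 2 * α - 3) (by linarith) (zetaReal (2 * α - 2))
    (2 ^ (2 * α - 3) / (3 - 2 * α))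
  have ha : 0 < (2 : ℝ) ^ (α - 2) / (2 - α) := div_pos (by positivity) (by linarith)
  have hb : 0 < (2 : ℝ) ^ (2 * α - 3) / (3 - 2 * α) := div_pos (by positivity) (by linarith)
  have e1 : ∀ n : ℕ, approxS 1 α n = 2 * fCoeff α / gCoeff α *
      ((n : ℝ) ^ (α - 2) * zetaReal (α - 1) + 2 ^ (α - 2) / (2 - α)) := by
    intro n
    have q2 : 1 * α - 1 = α - 1 := by ring
    have q4 : α - 1 - 1 = α - 2 := by ring
    have q3 : 1 + 1 - 1 * α = 2 - α := by ring
    simp only [approxS, Nat.cast_one, pow_one, q2, q3, q4]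
  have e2 : ∀ n : ℕ, approxS 2 α n = 2 * fCoeff α ^ 2 / gCoeff α ^ 2 *
      ((n : ℝ) ^ (2 * α - 3) * zetaReal (2 * α - 2) + 2 ^ (2 * α - 3) / (3 - 2 * α)) := by
    intro n
    have q1 : 2 * α - 2 - 1 = 2 * α - 3 := by ring
    have q3 : 1 + 2 - 2 * α = 3 - 2 * α := by ring
    simp only [approxS, Nat.cast_ofNat, q1, q3]
  have key : ∀ᶠ n : ℕ in atTop, approxAmplitude α n ^ 2 =
      2 * ((n : ℝ) ^ (α - 2) * zetaReal (α - 1) + 2 ^ (α - 2) / (2 - α)) ^ 2 /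
        ((n : ℝ) ^ (2 * α - 3) * zetaReal (2 * α - 2) + 2 ^ (2 * α - 3) / (3 - 2 * α)) := by
    -- The square root of the denominator can be squared away only where that sum is nonnegative;
    -- the zeta term has no controlled sign, but it vanishes in the limit.
    filter_upwards [hB.eventually_const_lt hb] with n hn
    rw [approxAmplitude, div_pow, Real.sq_sqrt (by rw [e2]; positivity), e1, e2]
    field_simp
  have hlim : 2 * ((2 : ℝ) ^ (α - 2) / (2 - α)) ^ 2 / (2 ^ (2 * α - 3) / (3 - 2 * α)) =
      (3 - 2 * α) / (2 - α) ^ 2 := by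
    have : (2 : ℝ) ^ (2 * α - 3) = 2 * (2 ^ (α - 2)) ^ 2 := by
      rw [← Real.rpow_natCast, ← Real.rpow_mul zero_le_two, ← Real.rpow_one_add' zero_le_two
        (by push_cast; linarith)]
      congr 1; push_cast; ring
    have h3 : (2 - α) ≠ 0 := by linarith
    have h4 : (3 - 2 * α) ≠ 0 := by linarith
    have h5 : (2 : ℝ) ^ (α - 2) ≠ 0 := by positivity
    rw [this]
    field_simp
  have hsq : Tendsto (fun n : ℕ => approxAmplitude α n ^ 2) atTop
      (𝓝 ((3 - 2 * α) / (2 - α) ^ 2)) := by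
    rw [← hlim]
    refine Tendsto.congr' (key.mono fun n hn => hn.symm) ?_
    exact ((hA.pow 2).const_mul 2).div hB hb.ne'
  refine ⟨key, ?_, hsq⟩
  have h := hsq.sqrt
  rw [Real.sqrt_div (by linarith), Real.sqrt_sq (by linarith)] at h
  refine h.congr' ?_
  filter_upwards [hA.eventually_const_lt ha] with n hn
  rw [Real.sqrt_sq]
  rw [approxAmplitude, e1]
  positivity

/-! ### Unitary evolution and approximate solutions of the Schrödinger equation. -/

section Evolution

variable {E : Type*} [NormedAddCommGroup E] [InnerProductSpace ℂ E] [CompleteSpace E]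

/-- The evolution operator `exp(-i t A)`. -/
noncomputable def evolution (A : E →L[ℂ] E) (t : ℝ) : E →L[ℂ] E :=
  NormedSpace.exp ((-(Complex.I * (t : ℂ))) • A)

theorem norm_evolution_apply_le {A : E →L[ℂ] E} (hA : IsSelfAdjoint A) (t : ℝ) (x : E) :
    ‖evolution A t x‖ ≤ ‖x‖ := by
  let +nondep : NormedAlgebra ℚ (E →L[ℂ] E) := .restrictScalars ℚ ℂ _
  have hskew : (-(Complex.I * (t : ℂ))) • A ∈ skewAdjoint (E →L[ℂ] E) := by
    rw [skewAdjoint.mem_iff, star_smul, hA.star_eq, ← neg_smul]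
    congr 1
    simp
  have hU : evolution A t ∈ unitary (E →L[ℂ] E) :=
    NormedSpace.exp_mem_unitary_of_mem_skewAdjoint hskew
  have h1 : ‖evolution A t‖ ≤ 1 := by
    -- A unitary has norm 1 only on a nonzero space; on the zero space the bound is trivial.
    nontriviality E
    exact (CStarRing.norm_of_mem_unitary hU).le
  simpa using (evolution A t).le_of_opNorm_le h1 x

theorem evolution_zero (A : E →L[ℂ] E) : evolution A 0 = 1 := by
  simp [evolution, NormedSpace.exp_zero]

theorem apply_evolution (A : E →L[ℂ] E) (t : ℝ) (x : E) :
    A (evolution A t x) = evolution A t (A x) := by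
  let +nondep : NormedAlgebra ℚ (E →L[ℂ] E) := .restrictScalars ℚ ℂ _
  have h : Commute A (evolution A t) := ((Commute.refl A).smul_right _).exp_right
  exact congrArg (fun B : E →L[ℂ] E => B x) h.eq

theorem hasDerivAt_evolution (A : E →L[ℂ] E) (t : ℝ) :
    HasDerivAt (evolution A) (evolution A t * (-Complex.I • A)) t := by
  have h := hasDerivAt_exp_smul_const (𝕂 := ℝ) (-Complex.I • A) t
  have e : ∀ u : ℝ, u • (-Complex.I • A) = (-(Complex.I * (u : ℂ))) • A := fun u => by
    rw [← Complex.coe_smul, smul_smul]; congr 1; ring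
  simp only [e] at h
  have e2 : (fun u : ℝ => NormedSpace.exp ((-(Complex.I * (u : ℂ))) • A)) = evolution A := rfl
  rw [e2] at h
  exact h

/-- An approximate solution of the Schrödinger equation stays close to the exact one. -/
theorem norm_evolution_sub_le {A : E →L[ℂ] E} (hA : IsSelfAdjoint A) {f f' : ℝ → E} {C T : ℝ}
    (hT : 0 ≤ T) (hf : ∀ t, HasDerivAt f (f' t) t)
    (hC : ∀ t, ‖f' t + Complex.I • A (f t)‖ ≤ C) :
    ‖f T - evolution A T (f 0)‖ ≤ C * T := by
  have hU : ∀ t, HasDerivAt (fun t => evolution A (T - t))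
      (-(evolution A (T - t) * (-Complex.I • A))) t := fun t => by
    have h := (hasDerivAt_evolution A (T - t)).scomp t ((hasDerivAt_id t).const_sub T)
    rw [neg_one_smul] at h
    exact h
  -- Duhamel: the derivative of e^{-i(T-t)A} f(t) is the evolved residual of f, whose norm is at
  -- most C.
  have hg : ∀ t, HasDerivAt (fun t => evolution A (T - t) (f t))
      (evolution A (T - t) (f' t + Complex.I • A (f t))) t := fun t => by
    have h : HasDerivAt (fun t => evolution A (T - t) (f t))
        ((-(evolution A (T - t) * (-Complex.I • A))) (f t) + evolution A (T - t) (f' t)) t :=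
      ((ContinuousLinearMap.restrictScalarsL ℂ E E ℝ ℝ).hasFDerivAt.comp_hasDerivAt t
      (hU t)).clm_apply (hf t)
    convert h using 1
    simp [add_comm]
  have h := norm_image_sub_le_of_norm_deriv_le_segment' (a := 0) (b := T) (C := C)
    (fun t _ => (hg t).hasDerivWithinAt)
    (fun t _ => (norm_evolution_apply_le hA _ _).trans (hC t)) T ⟨hT, le_rfl⟩
  simpa [evolution_zero] using h

end Evolution

/-! ### The abstract two-level reduction. -/

theorem norm_smul_of_nonneg {E : Type*} [NormedAddCommGroup E] [NormedSpace ℂ E] {r : ℝ}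
    (hr : 0 ≤ r) (x : E) : ‖(r : ℂ) • x‖ = r * ‖x‖ := by
  rw [norm_smul, Complex.norm_of_nonneg hr]

section TwoLevel

variable {E : Type*} [NormedAddCommGroup E] [InnerProductSpace ℂ E] [CompleteSpace E]

/-- The vectors through which the search reduces to a two-level problem, with energies measured
from the unperturbed band edge: `s` is the initial state, `w` the marked one, `u` spans together
with `s` an almost invariant plane, and `y` is the correction of `s`. -/
structure TwoLevel (A : E →L[ℂ] E) (N F : ℝ) (s w u y : E) : Prop where
  selfAdjoint : IsSelfAdjoint A
  pos_size : 0 < N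
  pos_fidelity : 0 < F
  norm_s : ‖s‖ = 1
  norm_w : ‖w‖ = 1
  inner_w_u : inner ℂ w u = 1
  apply_s : A s = ((1 / √N : ℝ) : ℂ) • w
  apply_u : A u = ((1 / √N : ℝ) : ℂ) • s
  apply_dressed : A (s + ((1 / √N : ℝ) : ℂ) • y) =
    ((F / √N : ℝ) : ℂ) • u + ((1 / N : ℝ) : ℂ) • s
  norm_u : ‖u‖ = 1 / √F

variable {A : E →L[ℂ] E} {N F : ℝ} {s w u y : E}

/-- The marked vector is √N A s, and A is self-adjoint and commutes with the evolution, so A can be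
moved onto the dressed state, where it has norm about √F/√N. The remaining terms come from replacing
s by the dressed state. -/
theorem TwoLevel.norm_inner_evolution_le (h : TwoLevel A N F s w u y) (t : ℝ) :
    ‖inner ℂ w (evolution A t s)‖ ≤ √F + 1 / √N + ‖y‖ / √N := by
  have hN := h.pos_size
  have hF := h.pos_fidelity
  set s' := s + ((1 / √N : ℝ) : ℂ) • y with hs'
  have hw : w = ((√N : ℝ) : ℂ) • A s := by
    rw [h.apply_s, smul_smul, ← Complex.ofReal_mul, mul_one_div_cancel (by positivity),
      Complex.ofReal_one, one_smul]
  have hA' : ‖A s'‖ ≤ √F / √N + 1 / N := by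
    rw [h.apply_dressed]
    refine (norm_add_le _ _).trans_eq ?_
    rw [norm_smul_of_nonneg (by positivity), norm_smul_of_nonneg (by positivity), h.norm_u,
      h.norm_s]
    have : F = √F * √F := (Real.mul_self_sqrt hF.le).symm
    field_simp
    nlinarith
  have e1 : inner ℂ w (evolution A t s') = ((√N : ℝ) : ℂ) * inner ℂ s (evolution A t (A s')) := by
    rw [hw, inner_smul_left, Complex.conj_ofReal, ← apply_evolution]
    congr 1
    exact h.selfAdjoint.isSymmetric s _
  have b1 : ‖inner ℂ w (evolution A t s')‖ ≤ √F + 1 / √N := by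
    rw [e1, norm_mul, Complex.norm_of_nonneg (by positivity)]
    calc √N * ‖inner ℂ s (evolution A t (A s'))‖ ≤ √N * (‖s‖ * ‖evolution A t (A s')‖) := by
          gcongr; exact norm_inner_le_norm _ _
      _ ≤ √N * (1 * (√F / √N + 1 / N)) := by
          rw [h.norm_s]
          gcongr
          exact (norm_evolution_apply_le h.selfAdjoint _ _).trans hA'
      _ = √F + 1 / √N := by
          have : N = √N * √N := (Real.mul_self_sqrt hN.le).symm
          nth_rewrite 3 [this]
          field_simp
  have b2 : ‖inner ℂ w (evolution A t (((1 / √N : ℝ) : ℂ) • y))‖ ≤ ‖y‖ / √N := by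
    refine (norm_inner_le_norm _ _).trans ?_
    rw [h.norm_w, one_mul]
    refine (norm_evolution_apply_le h.selfAdjoint _ _).trans_eq ?_
    rw [norm_smul_of_nonneg (by positivity)]
    ring
  have e : inner ℂ w (evolution A t s) = inner ℂ w (evolution A t s') -
      inner ℂ w (evolution A t (((1 / √N : ℝ) : ℂ) • y)) := by
    rw [← inner_sub_right, ← map_sub, hs', add_sub_cancel_right]
  rw [e]
  exact (norm_sub_le _ _).trans (add_le_add b1 b2)

theorem TwoLevel.norm_inner_evolution_add_le (h : TwoLevel A N F s w u y) :
    ‖inner ℂ w (evolution A (Real.pi / 2 * √(N / F)) s) + Complex.I * ((√F : ℝ) : ℂ)‖ ≤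
      Real.pi / 2 * (‖y‖ / √N + 1 / (√F * √N)) + ‖y‖ / √N := by
  have hN := h.pos_size
  have hF := h.pos_fidelity
  have hpi := Real.pi_pos
  set s' := s + ((1 / √N : ℝ) : ℂ) • y with hs'
  set ω : ℝ := √F / √N with hω
  have hω0 : 0 < ω := by positivity
  set T : ℝ := Real.pi / 2 * √(N / F) with hT
  have hωT : ω * T = Real.pi / 2 := by
    rw [hω, hT, Real.sqrt_div hN.le]; field_simp
  have hT0 : 0 ≤ T := by positivity
  -- The exact rotation of an ideal two-level system from s' to -i√F u, used as an approximate
  -- solution.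
  set f : ℝ → E := fun t => ((Real.cos (ω * t) : ℝ) : ℂ) • s' -
    (Complex.I * ((√F * Real.sin (ω * t) : ℝ) : ℂ)) • u with hf
  set f' : ℝ → E := fun t => ((-Real.sin (ω * t) * ω : ℝ) : ℂ) • s' -
    (Complex.I * ((√F * (Real.cos (ω * t) * ω) : ℝ) : ℂ)) • u with hf'
  have hderiv : ∀ t, HasDerivAt f (f' t) t := fun t => by
    have hlin : HasDerivAt (fun t : ℝ => ω * t) ω t := by
      simpa using (hasDerivAt_id t).const_mul ω
    have h1 := hlin.cos.ofReal_comp.smul_const s'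
    have h2 := ((hlin.sin.const_mul √F).ofReal_comp.const_mul Complex.I).smul_const u
    exact h1.sub h2
  -- The leading terms cancel; what remains are the s/N defect of the dressed equation and the
  -- difference between s and s' in A u.
  have hres : ∀ t, f' t + Complex.I • A (f t) =
      (Complex.I * ((Real.cos (ω * t) / N : ℝ) : ℂ)) • s -
      ((Real.sin (ω * t) * ω / √N : ℝ) : ℂ) • y := fun t => by
    have hs : s = s' - ((1 / √N : ℝ) : ℂ) • y := by rw [hs', add_sub_cancel_right]
    have c1 : F / √N = √F * ω := by
      rw [hω, mul_div_assoc', Real.mul_self_sqrt hF.le]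
    have hd : A s' = ((F / √N : ℝ) : ℂ) • u + ((1 / N : ℝ) : ℂ) • s := h.apply_dressed
    simp only [hf, hf', map_sub, map_smul, hd, h.apply_u, c1]
    have c2 : ((√F * Real.sin (ω * t) : ℝ) : ℂ) * ((1 / √N : ℝ) : ℂ) =
        ((Real.sin (ω * t) * ω : ℝ) : ℂ) := by
      rw [← Complex.ofReal_mul]; congr 1; rw [hω]; ring
    have c3 : Complex.I • ((Complex.I * ((√F * Real.sin (ω * t) : ℝ) : ℂ)) •
        ((1 / √N : ℝ) : ℂ) • s) = - ((Real.sin (ω * t) * ω : ℝ) : ℂ) • s := by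
      rw [smul_smul, smul_smul, mul_assoc, mul_assoc, c2, ← mul_assoc, Complex.I_mul_I, neg_one_mul]
    rw [smul_sub, c3]
    have c4 : ((Real.sin (ω * t) * ω : ℝ) : ℂ) • s = ((Real.sin (ω * t) * ω : ℝ) : ℂ) • s' -
        ((Real.sin (ω * t) * ω / √N : ℝ) : ℂ) • y := by
      nth_rewrite 1 [hs]
      rw [smul_sub, smul_smul, ← Complex.ofReal_mul, mul_one_div]
    rw [neg_smul, c4]
    push_cast
    module
  have hbound : ∀ t, ‖f' t + Complex.I • A (f t)‖ ≤ 1 / N + ω * ‖y‖ / √N := fun t => by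
    rw [hres]
    refine (norm_sub_le _ _).trans (add_le_add ?_ ?_)
    · rw [norm_smul, norm_mul, Complex.norm_I, one_mul, h.norm_s, mul_one, Complex.norm_real,
        Real.norm_eq_abs, abs_div, abs_of_pos hN]
      gcongr
      exact Real.abs_cos_le_one _
    · rw [norm_smul, Complex.norm_real, Real.norm_eq_abs, abs_div, abs_mul, abs_of_pos hω0,
        abs_of_nonneg (Real.sqrt_nonneg N), div_mul_eq_mul_div]
      have := Real.abs_sin_le_one (ω * t)
      gcongr
      nlinarith
  have hclose := norm_evolution_sub_le h.selfAdjoint hT0 hderiv hbound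
  have hf0 : f 0 = s' := by simp [hf]
  have hfT : f T = -((Complex.I * ((√F : ℝ) : ℂ)) • u) := by
    simp only [hf, hωT, Real.cos_pi_div_two, Real.sin_pi_div_two]
    simp
  rw [hf0, hfT] at hclose
  have hs : s = s' - ((1 / √N : ℝ) : ℂ) • y := by rw [hs', add_sub_cancel_right]
  have e : inner ℂ w (evolution A T s) + Complex.I * ((√F : ℝ) : ℂ) =
      -inner ℂ w (-((Complex.I * ((√F : ℝ) : ℂ)) • u) - evolution A T s') -
        inner ℂ w (evolution A T (((1 / √N : ℝ) : ℂ) • y)) := by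
    nth_rewrite 1 [hs]
    rw [map_sub, inner_sub_right, inner_sub_right, inner_neg_right, inner_smul_right, h.inner_w_u]
    ring
  rw [e]
  refine (norm_sub_le _ _).trans (add_le_add ?_ ?_)
  · rw [norm_neg]
    refine (norm_inner_le_norm _ _).trans ?_
    rw [h.norm_w, one_mul]
    refine hclose.trans_eq ?_
    -- Integrating the residual over a quarter period multiplies it by π/(2ω) = (π/2)√N/√F.
    have hTe : T = Real.pi / 2 / ω := by rw [← hωT]; field_simp
    have hN2 : N = √N * √N := (Real.mul_self_sqrt hN.le).symm
    rw [hTe, add_mul, mul_add, add_comm]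
    congr 1
    · field_simp
    · rw [hω]; nth_rewrite 1 [hN2]; field_simp
  · refine (norm_inner_le_norm _ _).trans ?_
    rw [h.norm_w, one_mul]
    refine (norm_evolution_apply_le h.selfAdjoint _ _).trans_eq ?_
    rw [norm_smul_of_nonneg (by positivity)]
    ring

end TwoLevel

/-! ### Fourier analysis on the closed chain. -/

/-- The character `x ↦ exp(2 π i x / n)`. -/
noncomputable def character (n : ℕ) (x : ℂ) : ℂ := Complex.exp (2 * Real.pi * Complex.I * x / n)

theorem character_add (n : ℕ) (x y : ℂ) : character n (x + y) = character n x * character n y := by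
  rw [character, character, character, ← Complex.exp_add]
  congr 1; ring

theorem character_intCast_mul {n : ℕ} (hn : n ≠ 0) (m : ℤ) : character n (m * n) = 1 := by
  have hn' : (n : ℂ) ≠ 0 := by exact_mod_cast hn
  rw [character, Complex.exp_eq_one_iff]
  exact ⟨m, by field_simp⟩

theorem character_intCast_eq_one_iff {n : ℕ} (hn : n ≠ 0) (m : ℤ) :
    character n m = 1 ↔ (n : ℤ) ∣ m := by
  have hn' : (n : ℂ) ≠ 0 := by exact_mod_cast hn
  constructor
  · intro h
    rw [character, Complex.exp_eq_one_iff] at h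
    obtain ⟨l, hl⟩ := h
    have h2 : (m : ℂ) = n * l := by
      have := Complex.two_pi_I_ne_zero
      field_simp at hl
      linear_combination hl
    exact ⟨l, by exact_mod_cast h2⟩
  · rintro ⟨l, rfl⟩
    rw [← character_intCast_mul hn l]
    congr 1; push_cast; ring

theorem sum_character_eq_zero {n : ℕ} (hn : n ≠ 0) {m : ℤ} (hm : ¬ (n : ℤ) ∣ m) :
    ∑ k ∈ Finset.range n, character n (m * k) = 0 := by
  have hpow : ∀ k : ℕ, character n (m * k) = character n m ^ k := fun k => by
    rw [character, character, ← Complex.exp_nat_mul]; congr 1; ring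
  simp only [hpow]
  have h1 : character n m ≠ 1 := fun h => hm ((character_intCast_eq_one_iff hn m).1 h)
  have h2 := mul_geom_sum (character n m) n
  rw [← hpow, ← Int.cast_natCast (R := ℂ) n] at h2
  rw [Int.cast_natCast, character_intCast_mul hn, sub_self] at h2
  exact (mul_eq_zero.1 h2).resolve_left (sub_ne_zero.2 h1)

theorem sum_character_self {n : ℕ} : ∑ k ∈ Finset.range n, character n (0 * k) = n := by
  simp [character]

theorem int_dvd_sub_iff {n i j : ℕ} (hi : i < n) (hj : j < n) :
    (n : ℤ) ∣ (i : ℤ) - j ↔ i = j := by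
  constructor
  · intro h
    have := Int.eq_zero_of_abs_lt_dvd h (by rw [abs_lt]; omega)
    omega
  · rintro rfl; simp

theorem conj_character (n : ℕ) (x : ℝ) :
    starRingEnd ℂ (character n x) = character n (-x) := by
  rw [character, character, ← Complex.exp_conj]
  congr 1
  simp [map_ofNat]

theorem character_add_character_neg (n : ℕ) (x : ℝ) :
    character n x + character n (-x) = ((2 * Real.cos (2 * Real.pi * x / n) : ℝ) : ℂ) := by
  push_cast
  rw [Complex.two_cos, character, character]
  congr 2 <;> ring

/-- The eigenvalue as the Fourier transform of the couplings. -/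
theorem sum_coupling_mul_character (α : ℝ) {n : ℕ} (hn : n ≠ 0) (k : ℕ) :
    ∑ r ∈ Finset.Ico 1 n, (coupling α n r : ℂ) * character n (k * r) = (eigenvalue α n k : ℂ) := by
  have h1 : ∀ r : ℕ, (coupling α n r : ℂ) * character n (k * r) =
      ((1 / (r : ℝ) ^ α : ℝ) : ℂ) * character n (k * r) +
      ((1 / ((n : ℝ) - r) ^ α : ℝ) : ℂ) * character n (k * r) := fun r => by
    rw [coupling, Complex.ofReal_add, add_mul]
  -- The reflection r ↦ n - r exchanges the two halves of the coupling and inverts the character;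
  -- the two halves then combine to a cosine.
  have h2 : ∑ r ∈ Finset.Ico 1 n, ((1 / ((n : ℝ) - r) ^ α : ℝ) : ℂ) * character n (k * r) =
      ∑ r ∈ Finset.Ico 1 n, ((1 / (r : ℝ) ^ α : ℝ) : ℂ) * character n (-(k * r)) := by
    have h := Finset.sum_Ico_reflect
      (fun r : ℕ => ((1 / (r : ℝ) ^ α : ℝ) : ℂ) * character n (-(k * r))) 1 (m := n) (n := n)
      (by omega)
    rw [show n + 1 - n = 1 by omega, show n + 1 - 1 = n by omega] at h
    rw [← h]
    refine Finset.sum_congr rfl fun r hr => ?_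
    have hrn : r ≤ n := (Finset.mem_Ico.1 hr).2.le
    rw [Nat.cast_sub hrn]
    congr 1
    have e : (-(k * ((n - r : ℕ) : ℂ))) = ((-k : ℤ) : ℂ) * n + k * r := by
      push_cast [Nat.cast_sub hrn]; ring
    rw [e, character_add, character_intCast_mul hn, one_mul]
  rw [Finset.sum_congr rfl fun r _ => h1 r, Finset.sum_add_distrib, h2, ← Finset.sum_add_distrib,
    eigenvalue, Finset.mul_sum, Complex.ofReal_sum]
  refine Finset.sum_congr rfl fun r _ => ?_
  have h := character_add_character_neg n (k * r : ℝ)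
  push_cast at h
  rw [← mul_add, h]
  push_cast
  rw [show 2 * (Real.pi : ℂ) * k * r / n = 2 * Real.pi * (k * r) / n by ring]
  ring

/-- The Hamiltonian is circulant: the coupling is symmetric under r ↦ n - r, so its entries depend
only on j - i modulo n, which is subtraction in `Fin n`. Translation by i reduces to a single row.
-/
theorem sum_hamiltonian_mul_character (α : ℝ) {n : ℕ} (k : ℕ) (i : Fin n) :
    ∑ j : Fin n, hamiltonian α n i j * character n (k * ((j : ℕ) - (i : ℕ))) =
      (eigenvalue α n k : ℂ) := by
  have hn : n ≠ 0 := by have := i.2; omega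
  have : NeZero n := ⟨hn⟩
  set φ : ℕ → ℂ := fun r => if r = 0 then 0 else (coupling α n r : ℂ) * character n (k * r) with hφ
  have h1 : ∀ j : Fin n, hamiltonian α n i j * character n (k * ((j : ℕ) - (i : ℕ))) =
      φ ((j - i : Fin n) : ℕ) := by
    intro j
    rcases lt_trichotomy i j with h | rfl | h
    · have hv : ((j - i : Fin n) : ℕ) = (j : ℕ) - i := Fin.sub_val_of_le h.le
      have hlt : (i : ℕ) < j := h
      have hr : (((j : ℕ) - i : ℕ) : ℝ) = (j : ℕ) - (i : ℕ) := Nat.cast_sub hlt.le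
      have hc : (((j : ℕ) - i : ℕ) : ℂ) = (j : ℕ) - (i : ℕ) := Nat.cast_sub hlt.le
      have hpos : (0 : ℝ) ≤ (j : ℕ) - (i : ℕ) := by rw [← hr]; positivity
      simp only [hφ, hv, hamiltonian, Matrix.of_apply]
      rw [if_neg h.ne, if_neg (by omega), hr, hc, abs_of_nonneg hpos]
    · simp [hφ, hamiltonian]
    · have hlt : (j : ℕ) < i := h
      have hi := i.2
      have hv : ((j - i : Fin n) : ℕ) = n + (j : ℕ) - i := by
        rw [Fin.val_sub, Nat.mod_eq_of_lt (by omega)]; omega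
      have hr : ((n + (j : ℕ) - i : ℕ) : ℝ) = n - ((i : ℕ) - (j : ℕ)) := by
        rw [Nat.cast_sub (by omega)]; push_cast; ring
      have hc : ((n + (j : ℕ) - i : ℕ) : ℂ) = n - ((i : ℕ) - (j : ℕ)) := by
        rw [Nat.cast_sub (by omega)]; push_cast; ring
      have habs : |((j : ℕ) : ℝ) - (i : ℕ)| = (i : ℕ) - (j : ℕ) := by
        have : ((j : ℕ) : ℝ) ≤ (i : ℕ) := by exact_mod_cast hlt.le
        rw [abs_sub_comm, abs_of_nonneg (by linarith)]
      simp only [hφ, hv, hamiltonian, Matrix.of_apply]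
      rw [if_neg h.ne', if_neg (by omega), hr, hc, habs]
      congr 1
      · congr 1
        simp only [coupling, sub_sub_cancel]
        ring
      · have e : (k : ℂ) * (n - ((i : ℕ) - (j : ℕ))) =
            ((k : ℤ) : ℂ) * n + k * ((j : ℕ) - (i : ℕ)) := by push_cast; ring
        rw [e, character_add, character_intCast_mul hn, one_mul]
  have h2 : ∑ j : Fin n, φ ((j - i : Fin n) : ℕ) = ∑ j : Fin n, φ j :=
    (Equiv.subRight i).sum_comp (fun j : Fin n => φ (j : ℕ))
  rw [Finset.sum_congr rfl fun j _ => h1 j, h2, Fin.sum_univ_eq_sum_range,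
    Finset.range_eq_Ico, Finset.sum_eq_sum_Ico_succ_bot (by omega),
    ← sum_coupling_mul_character α hn k]
  simp only [hφ, if_true, zero_add]
  refine Finset.sum_congr rfl fun r hr => if_neg ?_
  have := (Finset.mem_Ico.1 hr).1
  omega

/-- The vector with Fourier coefficients `c`, relative to the site `w`. -/
noncomputable def fourierVec {n : ℕ} (w : Fin n) (c : ℕ → ℝ) : EuclideanSpace ℂ (Fin n) :=
  WithLp.toLp 2 fun j => (1 / (n : ℂ)) *
    ∑ k ∈ Finset.range n, (c k : ℂ) * character n (k * ((j : ℕ) - (w : ℕ)))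

section FourierVec

variable {n : ℕ} (w : Fin n)

theorem fourierVec_apply (c : ℕ → ℝ) (j : Fin n) : fourierVec w c j = (1 / (n : ℂ)) *
    ∑ k ∈ Finset.range n, (c k : ℂ) * character n (k * ((j : ℕ) - (w : ℕ))) := rfl

theorem fourierVec_congr {c d : ℕ → ℝ} (h : ∀ k < n, c k = d k) :
    fourierVec w c = fourierVec w d := by
  ext j
  rw [fourierVec_apply, fourierVec_apply]
  congr 1
  refine Finset.sum_congr rfl fun k hk => ?_
  rw [h k (Finset.mem_range.1 hk)]

theorem fourierVec_add (c d : ℕ → ℝ) :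
    fourierVec w (fun k => c k + d k) = fourierVec w c + fourierVec w d := by
  ext j
  rw [PiLp.add_apply, fourierVec_apply, fourierVec_apply, fourierVec_apply, ← mul_add,
    ← Finset.sum_add_distrib]
  congr 1
  refine Finset.sum_congr rfl fun k _ => ?_
  push_cast; ring

theorem fourierVec_smul (r : ℝ) (c : ℕ → ℝ) :
    fourierVec w (fun k => r * c k) = (r : ℂ) • fourierVec w c := by
  ext j
  rw [PiLp.smul_apply, fourierVec_apply, fourierVec_apply, smul_eq_mul, Finset.mul_sum,
    Finset.mul_sum, Finset.mul_sum]
  refine Finset.sum_congr rfl fun k _ => ?_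
  push_cast; ring

/-- With the normalisation 1/n, overlap with the marked site is the mean of the coefficients. -/
theorem fourierVec_apply_self (c : ℕ → ℝ) :
    fourierVec w c w = ((1 / (n : ℝ) * ∑ k ∈ Finset.range n, c k : ℝ) : ℂ) := by
  rw [fourierVec_apply]
  simp [character]

theorem fourierVec_one : fourierVec w (fun _ => 1) = EuclideanSpace.single w (1 : ℂ) := by
  have hn : n ≠ 0 := by have := w.2; omega
  have hn' : (n : ℂ) ≠ 0 := by exact_mod_cast hn
  ext j
  rw [fourierVec_apply, PiLp.single_apply]
  have e : ∀ k : ℕ, ((1 : ℝ) : ℂ) * character n (k * ((j : ℕ) - (w : ℕ))) =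
      character n (((j : ℤ) - (w : ℤ) : ℤ) * k) := fun k => by
    rw [Complex.ofReal_one, one_mul]; congr 1; push_cast; ring
  simp only [e]
  split_ifs with h
  · subst h
    rw [sub_self, Int.cast_zero, sum_character_self]
    field_simp
  · rw [sum_character_eq_zero hn, mul_zero]
    rw [int_dvd_sub_iff j.2 w.2]
    exact fun h' => h (Fin.ext h')

/-- Parseval: after expanding the square, orthogonality of characters kills the terms with k ≠ l. -/
theorem norm_fourierVec_sq (c : ℕ → ℝ) :
    ‖fourierVec w c‖ ^ 2 = 1 / (n : ℝ) * ∑ k ∈ Finset.range n, c k ^ 2 := by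
  have hn : n ≠ 0 := by have := w.2; omega
  have hn' : (n : ℂ) ≠ 0 := by exact_mod_cast hn
  rw [EuclideanSpace.norm_sq_eq]
  apply Complex.ofReal_injective
  have h1 : ∀ j : Fin n, ((‖fourierVec w c j‖ ^ 2 : ℝ) : ℂ) = (1 / (n : ℂ)) ^ 2 *
      ∑ k ∈ Finset.range n, ∑ l ∈ Finset.range n, (c k : ℂ) * c l *
        character n (-(((k : ℤ) - l : ℤ) * (w : ℕ))) *
        character n (((k : ℤ) - l : ℤ) * (j : ℕ)) := by
    intro j
    push_cast
    rw [← Complex.mul_conj', fourierVec_apply, map_mul, map_sum, mul_mul_mul_comm,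
      Finset.sum_mul_sum]
    congr 1
    · simp [sq]
    · refine Finset.sum_congr rfl fun k _ => Finset.sum_congr rfl fun l _ => ?_
      have hc := conj_character n ((l : ℝ) * ((j : ℕ) - (w : ℕ)))
      push_cast at hc
      rw [map_mul, Complex.conj_ofReal, hc, mul_mul_mul_comm, mul_assoc (_ * _) (character n _),
        ← character_add, ← character_add]
      congr 2
      ring
  have h2 : ∀ k ∈ Finset.range n, ∑ l ∈ Finset.range n, ∑ j : Fin n, (c k : ℂ) * c l *
        character n (-(((k : ℤ) - l : ℤ) * (w : ℕ))) *
        character n (((k : ℤ) - l : ℤ) * (j : ℕ)) = n * (c k : ℂ) ^ 2 := by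
    intro k hk
    have h3 : ∀ l ∈ Finset.range n, l ≠ k → ∑ j : Fin n, (c k : ℂ) * c l *
        character n (-(((k : ℤ) - l : ℤ) * (w : ℕ))) *
        character n (((k : ℤ) - l : ℤ) * (j : ℕ)) = 0 := by
      intro l hl hlk
      rw [← Finset.mul_sum, Fin.sum_univ_eq_sum_range
        (fun j : ℕ => character n (((k : ℤ) - l : ℤ) * (j : ℕ))), sum_character_eq_zero hn, mul_zero]
      rw [int_dvd_sub_iff (Finset.mem_range.1 hk) (Finset.mem_range.1 hl)]
      exact hlk.symm
    rw [Finset.sum_eq_single_of_mem k hk h3, ← Finset.mul_sum, Fin.sum_univ_eq_sum_range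
        (fun j : ℕ => character n (((k : ℤ) - k : ℤ) * (j : ℕ)))]
    rw [sub_self, Int.cast_zero, sum_character_self]
    simp [character]
    ring
  rw [Complex.ofReal_sum, Finset.sum_congr rfl fun j _ => h1 j, ← Finset.mul_sum, Finset.sum_comm,
    Finset.sum_congr rfl fun k _ => Finset.sum_comm, Finset.sum_congr rfl h2, ← Finset.mul_sum]
  push_cast
  field_simp

theorem hamiltonian_mulVec_fourierVec (α : ℝ) (c : ℕ → ℝ) :
    (hamiltonian α n).mulVec (fourierVec w c).ofLp =
      (fourierVec w fun k => eigenvalue α n k * c k).ofLp := by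
  funext i
  rw [fourierVec_apply]
  simp only [Matrix.mulVec, dotProduct, fourierVec_apply]
  simp only [Finset.mul_sum]
  rw [Finset.sum_comm]
  refine Finset.sum_congr rfl fun k _ => ?_
  rw [Complex.ofReal_mul, ← sum_hamiltonian_mul_character α k i, Finset.sum_mul, Finset.sum_mul,
    Finset.mul_sum]
  refine Finset.sum_congr rfl fun j _ => ?_
  have e : (k : ℂ) * ((j : ℕ) - (w : ℕ)) =
      k * ((j : ℕ) - (i : ℕ)) + k * ((i : ℕ) - (w : ℕ)) := by ring
  rw [e, character_add]
  ring

end FourierVec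

/-! ### The critical hopping rate and the inverse excitation energies. -/

theorem S_pos {α : ℝ} (hα : 1 < α) {n : ℕ} (hn : 2 ≤ n) (q : ℕ) : 0 < S q α n := by
  have hn' : (0 : ℝ) < n := by exact_mod_cast (by omega : 0 < n)
  have hg := gap_half_pos hα hn
  rw [S_eq_gap hg.ne']
  refine mul_pos (by positivity) (Finset.sum_pos (fun k hk => ?_) ⟨1, by simp; omega⟩)
  rw [Finset.mem_Ico] at hk
  exact pow_pos (div_pos hg (gap_pos hα hk.1 hk.2)) _

theorem gap_zero (α : ℝ) {n : ℕ} (hn : n ≠ 0) : gap α n 0 = 0 := by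
  rw [gap_eq α hn]; simp

/-- The hopping rate at which the marked state couples resonantly to the initial one. -/
noncomputable def criticalRate (α : ℝ) (n : ℕ) : ℝ :=
  -- The first branch is the mean of the inverse gaps; the value 1 elsewhere only keeps the rate
  -- positive for every n.
  if 2 ≤ n ∧ 1 < α then S 1 α n / gap α n (n / 2) else 1

theorem criticalRate_pos (α : ℝ) (n : ℕ) : 0 < criticalRate α n := by
  unfold criticalRate
  split_ifs with h
  · exact div_pos (S_pos h.2 h.1 1) (gap_half_pos h.2 h.1)
  · exact one_pos

/-- The inverse excitation energies at the critical rate; the entry at `0` vanishes. -/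
noncomputable def inverseEnergy (α : ℝ) (n k : ℕ) : ℝ := (criticalRate α n * gap α n k)⁻¹

theorem inverseEnergy_eq {α : ℝ} (hα : 1 < α) {n : ℕ} (hn : 2 ≤ n) (k : ℕ) :
    inverseEnergy α n k = (S 1 α n)⁻¹ * (gap α n (n / 2) / gap α n k) := by
  rw [inverseEnergy, criticalRate, if_pos ⟨hn, hα⟩, mul_inv, inv_div]
  ring

/-- The mode k = 0 contributes nothing because its entry is 0⁻¹ = 0 and q ≠ 0. For q = 1 the mean is
1, which is the resonance condition; for q = 2 it is 1/F_n. -/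
theorem mean_inverseEnergy_pow {α : ℝ} (hα : 1 < α) {n : ℕ} (hn : 2 ≤ n) {q : ℕ} (hq : q ≠ 0) :
    1 / (n : ℝ) * ∑ k ∈ Finset.range n, inverseEnergy α n k ^ q = S q α n / S 1 α n ^ q := by
  rw [Finset.range_eq_Ico, Finset.sum_eq_sum_Ico_succ_bot (by omega),
    S_eq_gap (gap_half_pos hα hn).ne' q]
  have h0 : inverseEnergy α n 0 ^ q = 0 := by
    rw [inverseEnergy, gap_zero α (by omega), mul_zero, inv_zero, zero_pow hq]
  rw [h0, zero_add, zero_add, mul_div_assoc, Finset.sum_div]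
  congr 1
  refine Finset.sum_congr rfl fun k _ => ?_
  rw [inverseEnergy_eq hα hn, mul_pow, inv_pow]
  ring

theorem analyticalFidelity_eq {α : ℝ} (hα : 1 < α) {n : ℕ} (hn : 2 ≤ n) :
    analyticalFidelity α n = S 1 α n ^ 2 / S 2 α n := by
  rw [analyticalFidelity, amplitude, div_pow, Real.sq_sqrt (S_pos hα hn 2).le]

theorem analyticalFidelity_pos {α : ℝ} (hα : 1 < α) {n : ℕ} (hn : 2 ≤ n) :
    0 < analyticalFidelity α n := by
  rw [analyticalFidelity_eq hα hn]
  exact div_pos (pow_pos (S_pos hα hn 1) 2) (S_pos hα hn 2)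

theorem mean_inverseEnergy {α : ℝ} (hα : 1 < α) {n : ℕ} (hn : 2 ≤ n) :
    1 / (n : ℝ) * ∑ k ∈ Finset.range n, inverseEnergy α n k = 1 := by
  have h := mean_inverseEnergy_pow hα hn one_ne_zero
  simpa [(S_pos hα hn 1).ne'] using h

theorem mean_inverseEnergy_sq {α : ℝ} (hα : 1 < α) {n : ℕ} (hn : 2 ≤ n) :
    1 / (n : ℝ) * ∑ k ∈ Finset.range n, inverseEnergy α n k ^ 2 =
      1 / analyticalFidelity α n := by
  rw [mean_inverseEnergy_pow hα hn two_ne_zero, analyticalFidelity_eq hα hn, one_div_div]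

theorem inverseEnergy_nonneg (α : ℝ) (n k : ℕ) : 0 ≤ inverseEnergy α n k :=
  inv_nonneg.2 (mul_nonneg (criticalRate_pos α n).le (gap_nonneg α n k))

/-- A nonzero wave number is at distance at least 1/n from the band edge, where the gap is still of
order at least n^{-(α-1)}. -/
theorem inverseEnergy_le {α : ℝ} (hα : 1 < α) {n k : ℕ} (hn : 2 ≤ n) (hk : k < n) :
    inverseEnergy α n k ≤
      8 * (∑' j : ℕ, 1 / (j : ℝ) ^ α) / S 1 α n * (n : ℝ) ^ (α - 1) := by
  have hn' : (0 : ℝ) < n := by exact_mod_cast (by omega : 0 < n)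
  have hG := tsum_one_div_rpow_pos hα
  have hS := S_pos hα hn 1
  rcases Nat.eq_zero_or_pos k with rfl | hk1
  · rw [inverseEnergy, gap_zero α (by omega), mul_zero, inv_zero]; positivity
  have hα1 : 0 ≤ α - 1 := by linarith
  have hk1' : (1 : ℝ) ≤ k := by exact_mod_cast hk1
  have hkn : (k : ℝ) + 1 ≤ n := by exact_mod_cast hk
  have hmin : 1 / (n : ℝ) ≤ 2 * min (k / n : ℝ) (1 - k / n) := by
    have h1 : 1 / (n : ℝ) ≤ k / n := by gcongr
    have h2 : 1 / (n : ℝ) ≤ 1 - k / n := by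
      rw [le_sub_iff_add_le, ← add_div, div_le_one hn']; linarith
    have h3 : 0 ≤ 1 / (n : ℝ) := by positivity
    linarith [le_min h1 h2]
  have hg : (1 / 2) * (1 / (n : ℝ)) ^ (α - 1) ≤ gap α n k :=
    le_trans (by gcongr) (gap_lower_bound hα hk1 hk)
  rw [inverseEnergy_eq hα hn]
  calc _ ≤ (S 1 α n)⁻¹ * ((4 * ∑' j : ℕ, 1 / (j : ℝ) ^ α) /
        ((1 / 2) * (1 / (n : ℝ)) ^ (α - 1))) := by
        refine mul_le_mul_of_nonneg_left ?_ (inv_nonneg.2 hS.le)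
        exact div_le_div₀ (by positivity) (gap_le_tsum hα _ _) (by positivity) hg
    _ = _ := by
        rw [Real.div_rpow zero_le_one hn'.le, Real.one_rpow]
        field_simp
        ring

/-! ### The search Hamiltonian as an instance of the two-level reduction. -/

theorem hamiltonian_isHermitian (α : ℝ) (n : ℕ) : (hamiltonian α n).IsHermitian := by
  ext i j
  rw [Matrix.conjTranspose_apply]
  simp only [hamiltonian, Matrix.of_apply]
  rcases eq_or_ne i j with rfl | h
  · simp
  · rw [if_neg h, if_neg h.symm, abs_sub_comm]
    exact Complex.conj_ofReal _

/-- The search Hamiltonian as an operator. -/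
noncomputable def searchOperator (α γ : ℝ) {n : ℕ} (w : Fin n) :
    EuclideanSpace ℂ (Fin n) →L[ℂ] EuclideanSpace ℂ (Fin n) :=
  Matrix.toEuclideanCLM (n := Fin n) (𝕜 := ℂ) (searchHamiltonian α γ n w)

/-- The search Hamiltonian with energies measured from the largest eigenvalue of `γ H`. -/
noncomputable def shiftedOperator (α γ : ℝ) {n : ℕ} (w : Fin n) :
    EuclideanSpace ℂ (Fin n) →L[ℂ] EuclideanSpace ℂ (Fin n) :=
  searchOperator α γ w - ((γ * eigenvalue α n n : ℝ) : ℂ) • 1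

theorem isSelfAdjoint_shiftedOperator (α γ : ℝ) {n : ℕ} (w : Fin n) :
    IsSelfAdjoint (shiftedOperator α γ w) := by
  have hr : ∀ r : ℝ, IsSelfAdjoint (r : ℂ) := fun r => Complex.conj_ofReal r
  have h1 : IsSelfAdjoint (searchHamiltonian α γ n w) := by
    refine ((hr γ).smul (hamiltonian_isHermitian α n)).add ?_
    change star _ = _
    rw [Matrix.star_eq_conjTranspose, Matrix.conjTranspose_single, star_one]
  have h2 : IsSelfAdjoint (((γ * eigenvalue α n n : ℝ) : ℂ) •
      (1 : EuclideanSpace ℂ (Fin n) →L[ℂ] EuclideanSpace ℂ (Fin n))) := (hr _).smul (.one _)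
  exact IsSelfAdjoint.sub (R := EuclideanSpace ℂ (Fin n) →L[ℂ] EuclideanSpace ℂ (Fin n))
    (h1.map (Matrix.toEuclideanCLM (n := Fin n) (𝕜 := ℂ))) h2

/-- In Fourier coefficients the chain part is diagonal with entries -γ gap, and the projector on the
marked site adds the mean of the coefficients to each of them. -/
theorem shiftedOperator_fourierVec (α γ : ℝ) {n : ℕ} (w : Fin n) (c : ℕ → ℝ) :
    shiftedOperator α γ w (fourierVec w c) = fourierVec w fun k =>
      1 / (n : ℝ) * ∑ l ∈ Finset.range n, c l - γ * gap α n k * c k := by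
  have h1 : searchOperator α γ w (fourierVec w c) =
      (γ : ℂ) • (fourierVec w fun k => eigenvalue α n k * c k) +
      ((1 / (n : ℝ) * ∑ l ∈ Finset.range n, c l : ℝ) : ℂ) • fourierVec w (fun _ => 1) := by
    rw [fourierVec_one]
    ext i
    change (searchHamiltonian α γ n w).mulVec (fourierVec w c).ofLp i = _
    rw [searchHamiltonian, Matrix.add_mulVec, Matrix.smul_mulVec, hamiltonian_mulVec_fourierVec,
      Matrix.single_mulVec, fourierVec_apply_self]
    simp [Function.update_apply, PiLp.single_apply]
  have h2 : (fun k => 1 / (n : ℝ) * ∑ l ∈ Finset.range n, c l - γ * gap α n k * c k) =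
      fun k => (γ * (eigenvalue α n k * c k) + (1 / (n : ℝ) * ∑ l ∈ Finset.range n, c l) * 1) +
        (-(γ * eigenvalue α n n)) * c k := by
    funext k
    simp only [gap]; ring
  rw [h2, fourierVec_add, fourierVec_add, fourierVec_smul, fourierVec_smul, fourierVec_smul, ← h1,
    shiftedOperator]
  simp [sub_eq_add_neg]

-- The identification of matrices with operators is an algebra isomorphism, continuous by finite
-- dimension, hence compatible with the exponential series.
open scoped Matrix.Norms.L2Operator in
theorem toEuclideanCLM_exp {n : ℕ} (X : Matrix (Fin n) (Fin n) ℂ) :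
    Matrix.toEuclideanCLM (n := Fin n) (𝕜 := ℂ) (NormedSpace.exp X) =
      NormedSpace.exp (Matrix.toEuclideanCLM (n := Fin n) (𝕜 := ℂ) X) := by
  let +nondep : NormedAlgebra ℚ (Matrix (Fin n) (Fin n) ℂ) := .restrictScalars ℚ ℂ _
  let f : Matrix (Fin n) (Fin n) ℂ →ₗ[ℂ]
      (EuclideanSpace ℂ (Fin n) →L[ℂ] EuclideanSpace ℂ (Fin n)) :=
    Matrix.toEuclideanCLM (n := Fin n) (𝕜 := ℂ)
  have hc : Continuous f := LinearMap.continuous_of_finiteDimensional f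
  exact NormedSpace.map_exp (Matrix.toEuclideanCLM (n := Fin n) (𝕜 := ℂ)) hc X

theorem evolution_add_smul_one {E : Type*} [NormedAddCommGroup E] [InnerProductSpace ℂ E]
    [CompleteSpace E] (A : E →L[ℂ] E) (c t : ℝ) :
    evolution (A + (c : ℂ) • 1) t = Complex.exp (-(Complex.I * t) * c) • evolution A t := by
  let +nondep : NormedAlgebra ℚ (E →L[ℂ] E) := .restrictScalars ℚ ℂ _
  have h := NormedSpace.algebraMap_exp_comm (𝕂 := ℂ) (𝔸 := E →L[ℂ] E) (-(Complex.I * t) * c)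
  rw [← Complex.exp_eq_exp_ℂ, Algebra.algebraMap_eq_smul_one, Algebra.algebraMap_eq_smul_one] at h
  rw [evolution, smul_add, smul_smul, NormedSpace.exp_add_of_commute, ← h, mul_smul_one]
  · rfl
  · exact (Commute.one_right _).smul_right _

/-- Shifting the energy multiplies the evolution by a phase, which the modulus removes. -/
theorem fidelity_eq (α γ : ℝ) {n : ℕ} (w : Fin n) (t : ℝ) :
    fidelity α γ n w t = ‖inner ℂ (EuclideanSpace.single w (1 : ℂ))
      (evolution (shiftedOperator α γ w) t (WithLp.toLp 2 (initialState n)))‖ ^ 2 := by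
  have h1 : searchOperator α γ w =
      shiftedOperator α γ w + ((γ * eigenvalue α n n : ℝ) : ℂ) • 1 := by
    rw [shiftedOperator, sub_add_cancel]
  have h2 : evolution (searchOperator α γ w) t = Matrix.toEuclideanCLM (n := Fin n) (𝕜 := ℂ)
      (NormedSpace.exp ((-(Complex.I * (t : ℂ))) • searchHamiltonian α γ n w)) := by
    rw [toEuclideanCLM_exp, map_smul]; rfl
  have h3 : ‖Complex.exp (-(Complex.I * t) * (γ * eigenvalue α n n : ℝ))‖ = 1 := by
    rw [Complex.norm_exp]; simp
  have h4 : (NormedSpace.exp ((-(Complex.I * (t : ℂ))) • searchHamiltonian α γ n w)).mulVec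
      (initialState n) w = evolution (searchOperator α γ w) t
        (WithLp.toLp 2 (initialState n)) w := by
    rw [h2]; rfl
  rw [fidelity, EuclideanSpace.inner_single_left, map_one, one_mul, h4, h1,
    evolution_add_smul_one, smul_apply, PiLp.smul_apply, norm_smul, h3, one_mul]

theorem toLp_initialState {n : ℕ} (w : Fin n) :
    WithLp.toLp 2 (initialState n) =
      ((√(n : ℝ) : ℝ) : ℂ) • fourierVec w (fun k => if k = 0 then 1 else 0) := by
  have hn : 0 < n := by have := w.2; omega
  have hn' : (0 : ℝ) < n := by exact_mod_cast hn
  ext j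
  rw [PiLp.smul_apply, fourierVec_apply, Finset.sum_eq_single_of_mem 0 (Finset.mem_range.2 hn)
    fun k _ hk => by simp [hk]]
  have h : 1 / √(n : ℝ) = √(n : ℝ) * (1 / n) := by
    nth_rewrite 3 [← Real.mul_self_sqrt hn'.le]; field_simp
  simp only [initialState, h]
  simp [character]

/-- In Fourier coefficients s is √n δ_0, w is the constant 1, u is b, and y is b - F b². The
identities reduce to γ gap_k b_k = 1 - δ_0(k) together with the means 1 of b and 1/F of b². -/
theorem twoLevel_search {α : ℝ} (hα : 1 < α) {n : ℕ} (hn : 2 ≤ n) (w : Fin n) :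
    TwoLevel (shiftedOperator α (criticalRate α n) w) n (analyticalFidelity α n)
      (WithLp.toLp 2 (initialState n)) (EuclideanSpace.single w 1)
      (fourierVec w (inverseEnergy α n))
      (fourierVec w fun k => inverseEnergy α n k +
        -analyticalFidelity α n * inverseEnergy α n k ^ 2) := by
  have hn0 : n ≠ 0 := by omega
  have hn' : (0 : ℝ) < n := by exact_mod_cast (by omega : 0 < n)
  have hF := analyticalFidelity_pos hα hn
  have hm1 := mean_inverseEnergy hα hn
  have hm2 := mean_inverseEnergy_sq hα hn
  have hsq : √(n : ℝ) * √(n : ℝ) = n := Real.mul_self_sqrt hn'.le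
  have hsq0 : √(n : ℝ) ≠ 0 := by positivity
  set F := analyticalFidelity α n
  set b := inverseEnergy α n with hb
  set γ := criticalRate α n with hγ
  set δ : ℕ → ℝ := fun k => if k = 0 then 1 else 0 with hδ
  have hδm : 1 / (n : ℝ) * ∑ k ∈ Finset.range n, δ k = 1 / n := by
    rw [Finset.sum_eq_single_of_mem 0 (Finset.mem_range.2 (by omega))
      fun k _ hk => by simp [hδ, hk]]
    simp [hδ]
  have hδg : ∀ k, γ * gap α n k * δ k = 0 := fun k => by
    rcases eq_or_ne k 0 with rfl | hk
    · rw [gap_zero α hn0]; ring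
    · simp [hδ, hk]
  have hbg : ∀ k < n, γ * gap α n k * b k = 1 - δ k := fun k hk => by
    rcases Nat.eq_zero_or_pos k with rfl | hk0
    · rw [gap_zero α hn0]; simp [hδ]
    · have h1 := gap_pos hα hk0 hk
      have h2 : 0 < γ := criticalRate_pos α n
      simp only [hδ, hb, inverseEnergy, if_neg hk0.ne']
      rw [mul_inv_cancel₀ (by positivity), sub_zero]
  have hs : WithLp.toLp 2 (initialState n) = ((√(n : ℝ) : ℝ) : ℂ) • fourierVec w δ :=
    toLp_initialState w
  have hAδ : shiftedOperator α γ w (fourierVec w δ) =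
      ((1 / n : ℝ) : ℂ) • EuclideanSpace.single w (1 : ℂ) := by
    rw [shiftedOperator_fourierVec, ← fourierVec_one, ← fourierVec_smul]
    refine fourierVec_congr w fun k _ => ?_
    rw [hδm, hδg, sub_zero, mul_one]
  refine ⟨isSelfAdjoint_shiftedOperator _ _ _, hn', hF, ?_, ?_, ?_, ?_, ?_, ?_, ?_⟩
  · have h : ‖(WithLp.toLp 2 (initialState n) : EuclideanSpace ℂ (Fin n))‖ ^ 2 = 1 := by
      rw [hs, norm_smul_of_nonneg (Real.sqrt_nonneg _), mul_pow, norm_fourierVec_sq,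
        Real.sq_sqrt hn'.le]
      have : ∀ k, δ k ^ 2 = δ k := fun k => by simp only [hδ]; split_ifs <;> norm_num
      rw [Finset.sum_congr rfl fun k _ => this k, hδm, mul_one_div_cancel hn'.ne']
    rwa [pow_eq_one_iff_of_nonneg (norm_nonneg _) two_ne_zero] at h
  · simp
  · rw [EuclideanSpace.inner_single_left, fourierVec_apply_self, hm1]; simp
  · rw [hs, map_smul, hAδ, smul_smul, ← Complex.ofReal_mul]
    congr 2
    nth_rewrite 2 [← hsq]; field_simp
  · rw [shiftedOperator_fourierVec, hs, smul_smul, ← Complex.ofReal_mul, one_div_mul_cancel hsq0,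
      Complex.ofReal_one, one_smul]
    refine fourierVec_congr w fun k hk => ?_
    rw [hm1, hbg k hk]; ring
  · have hy : shiftedOperator α γ w (fourierVec w fun k => b k + -F * b k ^ 2) =
        fourierVec w (fun k => -1 * 1 + (δ k + F * b k)) := by
      rw [shiftedOperator_fourierVec]
      refine fourierVec_congr w fun k hk => ?_
      -- The coefficient -F of b² makes y orthogonal to w, so the projector does not act on it.
      have hmean : 1 / (n : ℝ) * ∑ l ∈ Finset.range n, (b l + -F * b l ^ 2) = 0 := by
        rw [Finset.sum_add_distrib, ← Finset.mul_sum, mul_add, hm1, mul_left_comm, hm2]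
        field_simp; ring
      have hδb : δ k * b k = 0 := by
        rcases eq_or_ne k 0 with rfl | hk0
        · simp [hb, inverseEnergy, gap_zero α hn0]
        · simp [hδ, hk0]
      rw [hmean]
      linear_combination (-1 + F * b k) * hbg k hk - F * hδb
    rw [map_add, map_smul, hy, fourierVec_add, fourierVec_add, fourierVec_smul, fourierVec_smul,
      fourierVec_one, hs, map_smul, hAδ]
    have e1 : √(n : ℝ) * (1 / n) = 1 / √(n : ℝ) := by
      nth_rewrite 2 [← hsq]; field_simp
    rw [smul_smul, smul_smul, ← Complex.ofReal_mul, ← Complex.ofReal_mul, mul_comm (1 / (n : ℝ)), e1,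
      smul_add, smul_add, smul_smul, smul_smul, ← Complex.ofReal_mul, ← Complex.ofReal_mul,
      one_div_mul_eq_div]
    push_cast
    module
  · have h : ‖fourierVec w b‖ ^ 2 = 1 / F := by rw [norm_fourierVec_sq, hm2]
    rw [← Real.sqrt_sq (norm_nonneg (fourierVec w b)), h, Real.sqrt_div zero_le_one, Real.sqrt_one]

/-- By (b - F b²)² ≤ 2b² + 2F²b⁴ and b⁴ ≤ B²b², with B the uniform bound on b, only the mean of b²
is needed and no fourth moment enters. -/
theorem norm_correction_sq_le {α : ℝ} (hα : 1 < α) {n : ℕ} (hn : 2 ≤ n) (w : Fin n) :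
    ‖fourierVec w fun k => inverseEnergy α n k +
        -analyticalFidelity α n * inverseEnergy α n k ^ 2‖ ^ 2 ≤
      2 / analyticalFidelity α n + 2 * analyticalFidelity α n *
        (8 * (∑' j : ℕ, 1 / (j : ℝ) ^ α) / S 1 α n * (n : ℝ) ^ (α - 1)) ^ 2 := by
  have hF := analyticalFidelity_pos hα hn
  have hm2 := mean_inverseEnergy_sq hα hn
  have hB : ∀ k < n, inverseEnergy α n k ≤ _ := fun k hk => inverseEnergy_le hα hn hk
  set F := analyticalFidelity α n
  set B := 8 * (∑' j : ℕ, 1 / (j : ℝ) ^ α) / S 1 α n * (n : ℝ) ^ (α - 1)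
  rw [norm_fourierVec_sq]
  calc _ ≤ 1 / (n : ℝ) * ∑ k ∈ Finset.range n,
        (2 + 2 * F ^ 2 * B ^ 2) * inverseEnergy α n k ^ 2 := by
        refine mul_le_mul_of_nonneg_left (Finset.sum_le_sum fun k hk => ?_) (by positivity)
        have h0 := inverseEnergy_nonneg α n k
        have h1 := pow_le_pow_left₀ h0 (hB k (Finset.mem_range.1 hk)) 2
        set b := inverseEnergy α n k
        have h2 : (F * b) ^ 2 * b ^ 2 ≤ (F * b) ^ 2 * B ^ 2 := by gcongr
        nlinarith [sq_nonneg (b + F * b ^ 2)]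
    _ = _ := by
        rw [← Finset.mul_sum, mul_left_comm, hm2]
        field_simp

/-! ### Vanishing errors and the asymptotic success probability. -/

/-- An upper bound for the norm of the correction of the initial state. -/
noncomputable def correctionBound (α : ℝ) (n : ℕ) : ℝ :=
  √((2 / analyticalFidelity α n + 2 * analyticalFidelity α n *
    (8 * (∑' j : ℕ, 1 / (j : ℝ) ^ α) / S 1 α n * (n : ℝ) ^ (α - 1)) ^ 2) / n)

/-- The deviation of the search amplitude from its asymptotic value. -/
noncomputable def amplitudeError (α : ℝ) (n : ℕ) : ℝ :=
  Real.pi / 2 * (correctionBound α n + 1 / (√(analyticalFidelity α n) * √(n : ℝ))) +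
    correctionBound α n + 1 / √(n : ℝ)

theorem amplitude_nonneg {α : ℝ} (hα : 1 < α) {n : ℕ} (hn : 2 ≤ n) : 0 ≤ amplitude α n :=
  div_nonneg (S_pos hα hn 1).le (Real.sqrt_nonneg _)

theorem sqrt_analyticalFidelity {α : ℝ} (hα : 1 < α) {n : ℕ} (hn : 2 ≤ n) :
    √(analyticalFidelity α n) = amplitude α n :=
  Real.sqrt_sq (amplitude_nonneg hα hn)

theorem norm_correction_div_le {α : ℝ} (hα : 1 < α) {n : ℕ} (hn : 2 ≤ n) (w : Fin n) :
    ‖fourierVec w fun k => inverseEnergy α n k +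
        -analyticalFidelity α n * inverseEnergy α n k ^ 2‖ / √(n : ℝ) ≤ correctionBound α n := by
  have hn' : (0 : ℝ) < n := by exact_mod_cast (by omega : 0 < n)
  refine Real.le_sqrt_of_sq_le ?_
  rw [div_pow, Real.sq_sqrt hn'.le]
  gcongr
  exact norm_correction_sq_le hα hn w

theorem fidelity_le {α : ℝ} (hα : 1 < α) {n : ℕ} (hn : 2 ≤ n) (w : Fin n) (t : ℝ) :
    fidelity α (criticalRate α n) n w t ≤ (amplitude α n + amplitudeError α n) ^ 2 := by
  have h := (twoLevel_search hα hn w).norm_inner_evolution_le t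
  have hy := norm_correction_div_le hα hn w
  have hpi := Real.pi_pos
  have h0 : 0 ≤ Real.pi / 2 *
      (correctionBound α n + 1 / (√(analyticalFidelity α n) * √(n : ℝ))) :=
    mul_nonneg (by positivity) (add_nonneg (Real.sqrt_nonneg _) (by positivity))
  rw [fidelity_eq]
  refine pow_le_pow_left₀ (norm_nonneg _) (h.trans ?_) 2
  rw [sqrt_analyticalFidelity hα hn, amplitudeError]
  linarith

theorem le_fidelity_searchTime {α : ℝ} (hα : 1 < α) {n : ℕ} (hn : 2 ≤ n) (w : Fin n)
    (h0 : 0 ≤ amplitude α n - amplitudeError α n) :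
    (amplitude α n - amplitudeError α n) ^ 2 ≤
      fidelity α (criticalRate α n) n w (searchTime α n) := by
  have h := (twoLevel_search hα hn w).norm_inner_evolution_add_le
  have hy := norm_correction_div_le hα hn w
  have hpi := Real.pi_pos
  rw [fidelity_eq, searchTime]
  refine pow_le_pow_left₀ h0 ?_ 2
  set z := inner ℂ (EuclideanSpace.single w (1 : ℂ)) (evolution (shiftedOperator α (criticalRate α n) w)
    (Real.pi / 2 * √((n : ℝ) / analyticalFidelity α n)) (WithLp.toLp 2 (initialState n)))
  have h1 : ‖Complex.I * ((√(analyticalFidelity α n) : ℝ) : ℂ)‖ = amplitude α n := by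
    rw [norm_mul, Complex.norm_I, one_mul, sqrt_analyticalFidelity hα hn,
      Complex.norm_of_nonneg (amplitude_nonneg hα hn)]
  have h2 : amplitude α n ≤ ‖z + Complex.I * ((√(analyticalFidelity α n) : ℝ) : ℂ)‖ + ‖z‖ := by
    rw [← h1]
    refine le_trans (le_of_eq ?_) (norm_sub_le _ _)
    rw [add_sub_cancel_left]
  have h3 : 0 ≤ 1 / √(n : ℝ) := by positivity
  have h4 := mul_le_mul_of_nonneg_left hy (by positivity : 0 ≤ Real.pi / 2)
  rw [amplitudeError]
  linarith

theorem tendsto_amplitudeError {α F s : ℝ} (hα : α < 3 / 2) (hF : 0 < F) (hs : 0 < s)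
    (hFlim : Tendsto (fun n : ℕ => analyticalFidelity α n) atTop (𝓝 F))
    (hS : Tendsto (fun n : ℕ => S 1 α n) atTop (𝓝 s)) :
    Tendsto (fun n : ℕ => amplitudeError α n) atTop (𝓝 0) := by
  have hinv : Tendsto (fun n : ℕ => 1 / (n : ℝ)) atTop (𝓝 0) :=
    tendsto_const_nhds.div_atTop tendsto_natCast_atTop_atTop
  have hsqrt : Tendsto (fun n : ℕ => 1 / √(n : ℝ)) atTop (𝓝 0) :=
    tendsto_const_nhds.div_atTop (Real.tendsto_sqrt_atTop.comp tendsto_natCast_atTop_atTop)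
  have hpow : Tendsto (fun n : ℕ => (n : ℝ) ^ (2 * α - 3)) atTop (𝓝 0) := by
    have h := (tendsto_rpow_neg_atTop (y := 3 - 2 * α) (by linarith)).comp
      tendsto_natCast_atTop_atTop
    refine h.congr fun n => ?_
    simp only [Function.comp]
    congr 1; ring
  set G := ∑' j : ℕ, 1 / (j : ℝ) ^ α
  have hη : Tendsto (fun n : ℕ => correctionBound α n) atTop (𝓝 0) := by
    have h := (((tendsto_const_nhds (x := (2 : ℝ))).div hFlim hF.ne').mul hinv).add
      (((hFlim.const_mul 2).mul (((tendsto_const_nhds (x := 8 * G)).div hS hs.ne').pow 2)).mul hpow)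
    rw [mul_zero, mul_zero, add_zero] at h
    have h2 := h.sqrt
    rw [Real.sqrt_zero] at h2
    refine h2.congr' ?_
    filter_upwards [eventually_gt_atTop 0] with n hn
    have hn' : (0 : ℝ) < n := by exact_mod_cast hn
    -- This is the rate of ‖y‖²/n, and the point where α < 3/2 makes the correction negligible.
    have e : (n : ℝ) ^ (2 * α - 3) = ((n : ℝ) ^ (α - 1)) ^ 2 / n := by
      rw [← Real.rpow_natCast, ← Real.rpow_mul hn'.le, ← Real.rpow_sub_one hn'.ne']
      congr 1; push_cast; ring
    rw [correctionBound, e]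
    congr 1
    simp only [Pi.div_apply]
    ring
  have h := (((hη.add ((tendsto_const_nhds (x := (1 : ℝ))).div hFlim.sqrt
    (Real.sqrt_pos.2 hF).ne' |>.mul hsqrt)).const_mul (Real.pi / 2)).add hη).add hsqrt
  simp only [mul_zero, add_zero] at h
  refine h.congr fun n => ?_
  rw [amplitudeError]
  simp only [Pi.div_apply]
  congr 4
  rw [div_mul_div_comm, one_mul]

theorem searchTime_isBigO {α F : ℝ} (hF : 0 < F)
    (hFlim : Tendsto (fun n : ℕ => analyticalFidelity α n) atTop (𝓝 F)) :
    (fun n : ℕ => searchTime α n) =O[atTop] (fun n : ℕ => √(n : ℝ)) := by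
  have hpi := Real.pi_pos
  refine IsBigO.of_bound (Real.pi / 2 / √(F / 2)) ?_
  filter_upwards [hFlim.eventually_const_le (half_lt_self hF)] with n hn
  rw [Real.norm_of_nonneg (by unfold searchTime; positivity), Real.norm_of_nonneg (by positivity),
    searchTime, Real.sqrt_div (Nat.cast_nonneg n), ← mul_div_assoc, div_mul_eq_mul_div _ √(F / 2)]
  gcongr

/-- The fidelity at every time is at most (ν_n + error)², and at the search time it is at least (ν_n
- error)². Both bounds are uniform in the marked site and tend to ν². -/
theorem search_asymptotics {α : ℝ} (h1 : 1 < α) (h2 : α < 3 / 2) :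
    ∃ s₂ ν F : ℝ, 0 < s₂ ∧ 0 < ν ∧ F = ν ^ 2 ∧
      Tendsto (fun n : ℕ => S 2 α n) atTop (𝓝 s₂) ∧
      Tendsto (fun n : ℕ => amplitude α n) atTop (𝓝 ν) ∧
      Tendsto (fun n : ℕ => analyticalFidelity α n) atTop (𝓝 F) ∧
      (fun n : ℕ => searchTime α n) =O[atTop] (fun n : ℕ => √(n : ℝ)) ∧
      ∃ γ : ℕ → ℝ, (∀ n, 0 < γ n) ∧
        ∀ ε : ℝ, 0 < ε → ∀ᶠ n : ℕ in atTop, ∀ w : Fin n,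
          |fidelity α (γ n) n w (searchTime α n) - F| < ε ∧
          ∀ t : ℝ, fidelity α (γ n) n w t < F + ε := by
  obtain ⟨s₁, hs₁, hS₁⟩ := exists_tendsto_S h1 1 (by push_cast; linarith)
  obtain ⟨s₂, hs₂, hS₂⟩ := exists_tendsto_S h1 2 (by push_cast; linarith)
  have hν : 0 < s₁ / √s₂ := by positivity
  have hamp : Tendsto (fun n : ℕ => amplitude α n) atTop (𝓝 (s₁ / √s₂)) :=
    hS₁.div hS₂.sqrt (Real.sqrt_pos.2 hs₂).ne'
  have hF : Tendsto (fun n : ℕ => analyticalFidelity α n) atTop (𝓝 ((s₁ / √s₂) ^ 2)) := hamp.pow 2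
  refine ⟨s₂, s₁ / √s₂, (s₁ / √s₂) ^ 2, hs₂, hν, rfl, hS₂, hamp, hF,
    searchTime_isBigO (by positivity) hF, criticalRate α, criticalRate_pos α, fun ε hε => ?_⟩
  have herr := tendsto_amplitudeError h2 (by positivity) hs₁ hF hS₁
  have hup := (hamp.add herr).pow 2
  have hlow := hamp.sub herr
  have hlow2 := hlow.pow 2
  rw [add_zero] at hup
  rw [sub_zero] at hlow hlow2
  filter_upwards [eventually_ge_atTop 2, hlow.eventually_const_le hν,
    hup.eventually_lt_const (lt_add_of_pos_right _ hε),
    hlow2.eventually_const_lt (sub_lt_self _ hε)] with n hn e1 e2 e3 w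
  have hb : ∀ t : ℝ, fidelity α (criticalRate α n) n w t < (s₁ / √s₂) ^ 2 + ε := fun t =>
    (fidelity_le h1 hn w t).trans_lt e2
  refine ⟨?_, hb⟩
  have hl := le_fidelity_searchTime h1 hn w e1
  rw [abs_lt]
  exact ⟨by linarith, by linarith [hb (searchTime α n)]⟩

end LongRangeSearch

theorem mainTheorem3 (α : ℝ) :
    (1 < α → α < 2 →
      ∃ s₁ : ℝ, 0 < s₁ ∧ Tendsto (fun n : ℕ => LongRangeSearch.S 1 α n) atTop (𝓝 s₁)) ∧
    (1 < α → α < 3 / 2 →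
      ∃ s₂ ν F : ℝ, 0 < s₂ ∧ 0 < ν ∧ F = ν ^ 2 ∧
        Tendsto (fun n : ℕ => LongRangeSearch.S 2 α n) atTop (𝓝 s₂) ∧
        Tendsto (fun n : ℕ => LongRangeSearch.amplitude α n) atTop (𝓝 ν) ∧
        Tendsto (fun n : ℕ => LongRangeSearch.analyticalFidelity α n) atTop (𝓝 F) ∧
        (fun n : ℕ => LongRangeSearch.searchTime α n) =O[atTop] (fun n : ℕ => √(n : ℝ)) ∧
        ∃ γ : ℕ → ℝ, (∀ n, 0 < γ n) ∧
          ∀ ε : ℝ, 0 < ε → ∀ᶠ n : ℕ in atTop, ∀ w : Fin n,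
            |LongRangeSearch.fidelity α (γ n) n w (LongRangeSearch.searchTime α n) - F| < ε ∧
            ∀ t : ℝ, LongRangeSearch.fidelity α (γ n) n w t < F + ε) ∧
    (3 / 2 < α →
      Tendsto (fun n : ℕ => LongRangeSearch.S 2 α n) atTop atTop ∧
      Tendsto (fun n : ℕ => LongRangeSearch.amplitude α n) atTop (𝓝 0) ∧
      Tendsto (fun n : ℕ => LongRangeSearch.analyticalFidelity α n) atTop (𝓝 0)) ∧
    (1 < α → α < 3 / 2 →
      (∀ᶠ n : ℕ in atTop, LongRangeSearch.approxAmplitude α n ^ 2 =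
        2 * ((n : ℝ) ^ (α - 2) * LongRangeSearch.zetaReal (α - 1) +
              2 ^ (α - 2) / (2 - α)) ^ 2 /
          ((n : ℝ) ^ (2 * α - 3) * LongRangeSearch.zetaReal (2 * α - 2) +
              2 ^ (2 * α - 3) / (3 - 2 * α))) ∧
      Tendsto (fun n : ℕ => LongRangeSearch.approxAmplitude α n) atTop
        (𝓝 (√(3 - 2 * α) / (2 - α))) ∧
      Tendsto (fun n : ℕ => LongRangeSearch.approxAmplitude α n ^ 2) atTop
        (𝓝 ((3 - 2 * α) / (2 - α) ^ 2))) := by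
  open LongRangeSearch in
  exact ⟨fun h1 h2 => exists_tendsto_S h1 1 (by push_cast; linarith),
    fun h1 h2 => search_asymptotics h1 h2,
    fun h => ⟨tendsto_S_two_atTop h, tendsto_amplitude_zero h, by
      simpa [analyticalFidelity] using (tendsto_amplitude_zero h).pow 2⟩,
    fun h1 h2 => approxAmplitude_asymptotics h1 h2⟩
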